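/- A quasi-symmetric 2-design (QSD) $\mathcal Q$ with parameters $(v,k,\lambda;b,r,\{x,y\})$, where $x\neq y$, consists of a set of $v$ points and a family of $b$ blocks (repeated blocks allowed), each block being a set of $k\geqslant 1$ points, such that every point lies in exactly $r$ blocks, every two distinct points lie together in exactly $\lambda$ blocks, and every two distinct members of the family of blocks meet in $x$ or $y$ points, both values occurring. Let $M$ be its points-by-blocks incidence matrix. The block graph $\mathsf B_x(\mathcal Q)$ has the blocks as vertices, two distinct blocks being adjacent when they meet in exactly $x$ points; let $X$ be its adjacency matrix. The total graph $\mathsf T_x(\mathcal Q)$ and the whole graph $\mathsf W_x(\mathcal Q)$ are the graphs on points and blocks with adjacency matrices $$\begin{bmatrix} O & M\\ M^\top & X\end{bmatrix}\quad\text{and}\quad \begin{bmatrix} J-I & M\\ M^\top & X\end{bmatrix}$$ respectively. The cone $\widehat\Gamma$ over a graph $\Gamma$ is obtained by adjoining a vertex adjacent to every vertex of $\Gamma$. For reals $\theta_0>\theta_1>\theta_2$, $\mathscr G_3(\theta_0,\theta_1,\theta_2)$ is the set of connected graphs whose distinct adjacency eigenvalues are exactly $\theta_0,\theta_1,\theta_2$.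 A graph is triregular if it has exactly three distinct vertex degrees. The coherent rank of a graph is the dimension of the smallest complex matrix algebra that contains $I$, $J$ and the adjacency matrix and is closed under transposition and entrywise product. **Theorem.** Let $\theta_1\geqslant 1$ and $\theta_2\leqslant -2$ be integers. Suppose $\mathcal Q$ is a QSD with parameters $(v,k,\lambda;b,r,\{x,y\})$ where $\mathsf B_x(\mathcal Q)\in\mathscr G_3(e_0,e_1,e_2)$ and $$(x,y)=\bigl(k+(\theta_1+1)(\theta_2+1)-(e_1+1)(e_2+1),\; k+\theta_1\theta_2-e_1e_2\bigr).$$ (i) If $\lambda=r+\theta_1\theta_2$, $\frac{r-\lambda+y-k}{x-y}=\theta_1+\theta_2$, and $$\begin{aligned} k+e_0-\theta_1-\theta_2&=\sqrt{(v+b+\theta_1\theta_2)(1+k+e_0+\theta_1\theta_2)},\\ r-\theta_1-\theta_2&=\sqrt{(v+b+\theta_1\theta_2)(1+\lambda)},\\ 1+\tfrac{\lambda k-yr}{x-y}&=\sqrt{(1+\lambda)(1+k+e_0+\theta_1\theta_2)},\end{aligned}$$ then $\widehat{\mathsf T_x(\mathcal Q)}\in\mathscr G_3(\theta_0,\theta_1,\theta_2)$,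 where $\theta_0$ is the largest eigenvalue of $\left[\begin{smallmatrix}0&v&b\\1&0&r\\1&k&e_0\end{smallmatrix}\right]$. Furthermore, if $|\{v+b,\,1+r,\,1+k+e_0\}|=3$ then $\widehat{\mathsf T_x(\mathcal Q)}$ is triregular and has coherent rank $14$. (ii) If $\lambda=r+(\theta_1+1)(\theta_2+1)$, $\frac{r-\lambda+y-k}{x-y}=\theta_1+\theta_2+1$, and $$\begin{aligned} k+e_0-\theta_1-\theta_2&=\sqrt{(v+b+\theta_1\theta_2)(1+k+e_0+\theta_1\theta_2)},\\ v-1+r-\theta_1-\theta_2&=\sqrt{(v+b+\theta_1\theta_2)(v+r+\theta_1\theta_2)},\\ 1+k+\tfrac{\lambda k-yr}{x-y}&=\sqrt{(v+r+\theta_1\theta_2)(1+k+e_0+\theta_1\theta_2)},\end{aligned}$$ then $\widehat{\mathsf W_x(\mathcal Q)}\in\mathscr G_3(\theta_0,\theta_1,\theta_2)$, where $\theta_0$ is the largest eigenvalue of $\left[\begin{smallmatrix}0&v&b\\1&v-1&r\\1&k&e_0\end{smallmatrix}\right]$. Furthermore, if $|\{v+b,\,v+r,\,1+k+e_0\}|=3$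 then $\widehat{\mathsf W_x(\mathcal Q)}$ is triregular and has coherent rank $14$. -/

import Mathlib

/-- A family `blk : B → Finset P` of blocks (repeated blocks are allowed) is a quasi-symmetric
`2`-design with parameters `(v, k, lam; b, r, {x, y})`. -/
structure IsQSD {P B : Type*} [Fintype P] [DecidableEq P] [Fintype B]
    (blk : B → Finset P) (v k lam b r x y : ℕ) : Prop where
  card_points : Fintype.card P = v
  card_blocks : Fintype.card B = b
  one_le_k : 1 ≤ k
  block_card : ∀ j, (blk j).card = k
  point_replication : ∀ p, (Finset.univ.filter fun j => p ∈ blk j).card = r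
  pair_replication : ∀ p q, p ≠ q →
    (Finset.univ.filter fun j => p ∈ blk j ∧ q ∈ blk j).card = lam
  x_ne_y : x ≠ y
  inter_card : ∀ i j, i ≠ j → (blk i ∩ blk j).card = x ∨ (blk i ∩ blk j).card = y
  x_occurs : ∃ i j, i ≠ j ∧ (blk i ∩ blk j).card = x
  y_occurs : ∃ i j, i ≠ j ∧ (blk i ∩ blk j).card = y

/-- The `x`-block graph: two distinct blocks are adjacent when they meet in exactly `x` points. -/
def blockGraph {P B : Type*} [DecidableEq P] (blk : B → Finset P) (x : ℕ) : SimpleGraph B where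
  Adj i j := i ≠ j ∧ (blk i ∩ blk j).card = x
  symm := ⟨fun i j h => ⟨h.1.symm, by rw [Finset.inter_comm]; exact h.2⟩⟩
  loopless := ⟨fun _ h => h.1 rfl⟩

/-- The adjacency relation on points and blocks given by a graph `H` on the points, incidence
between points and blocks, and the `x`-block graph on the blocks. -/
def pointBlockGraph {P B : Type*} [DecidableEq P] (H : SimpleGraph P) (blk : B → Finset P)
    (x : ℕ) : SimpleGraph (P ⊕ B) where
  Adj s t :=
    match s, t with
    | Sum.inl p, Sum.inl q => H.Adj p q
    | Sum.inl p, Sum.inr j => p ∈ blk j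
    | Sum.inr j, Sum.inl p => p ∈ blk j
    | Sum.inr i, Sum.inr j => (blockGraph blk x).Adj i j
  symm := ⟨by
    rintro (p | i) (q | j) h
    · exact H.adj_symm h
    · exact h
    · exact h
    · exact (blockGraph blk x).adj_symm h⟩
  loopless := ⟨by
    rintro (p | i) h
    · exact H.irrefl h
    · exact (blockGraph blk x).irrefl h⟩

/-- The `x`-total graph: no two points are adjacent. -/
def totalGraph {P B : Type*} [DecidableEq P] (blk : B → Finset P) (x : ℕ) :
    SimpleGraph (P ⊕ B) :=
  pointBlockGraph ⊥ blk x

/-- The `x`-whole graph: any two distinct points are adjacent. -/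
def wholeGraph {P B : Type*} [DecidableEq P] (blk : B → Finset P) (x : ℕ) :
    SimpleGraph (P ⊕ B) :=
  pointBlockGraph ⊤ blk x

/-- The cone over `G`: the new vertex `none` is adjacent to every vertex of `G`. -/
def coneGraph {V : Type*} (G : SimpleGraph V) : SimpleGraph (Option V) where
  Adj s t :=
    match s, t with
    | none, none => False
    | none, some _ => True
    | some _, none => True
    | some u, some w => G.Adj u w
  symm := ⟨by
    rintro (_ | u) (_ | w) h
    · exact h
    · exact trivial
    · exact trivial
    · exact G.adj_symm h⟩
  loopless := ⟨by
    rintro (_ | u) h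
    · exact h
    · exact G.irrefl h⟩

/-- The set of real eigenvalues of a real square matrix. -/
def realEigenvalues {n : Type*} [Fintype n] [DecidableEq n] (A : Matrix n n ℝ) : Set ℝ :=
  {μ | Module.End.HasEigenvalue (Matrix.toLin' A) μ}

open Classical in
/-- `G` is connected and its distinct eigenvalues are exactly `θ₀ > θ₁ > θ₂`. -/
def InG3 {V : Type*} [Fintype V] [DecidableEq V] (G : SimpleGraph V) (θ₀ θ₁ θ₂ : ℝ) : Prop :=
  G.Connected ∧ θ₁ < θ₀ ∧ θ₂ < θ₁ ∧ realEigenvalues (G.adjMatrix ℝ) = {θ₀, θ₁, θ₂}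

open Classical in
/-- `G` has exactly three distinct vertex degrees. -/
def IsTriregular {V : Type*} [Fintype V] (G : SimpleGraph V) : Prop :=
  (Set.range fun u => G.degree u).ncard = 3

/-- A coherent algebra: an algebra of complex matrices (so containing `I`) that contains the
all-ones matrix and is closed under transposition and under the entrywise product. -/
structure IsCoherentAlgebra {V : Type*} [Fintype V] [DecidableEq V]
    (S : Subalgebra ℂ (Matrix V V ℂ)) : Prop where
  allOnes_mem : (Matrix.of fun _ _ => (1 : ℂ)) ∈ S
  transpose_mem : ∀ M ∈ S, M.transpose ∈ S
  hadamard_mem : ∀ M ∈ S, ∀ N ∈ S, Matrix.hadamard M N ∈ S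

open Classical in
/-- The coherent closure of `G`: the smallest coherent algebra containing its adjacency matrix. -/
noncomputable def coherentClosure {V : Type*} [Fintype V] [DecidableEq V] (G : SimpleGraph V) :
    Subalgebra ℂ (Matrix V V ℂ) :=
  sInf {S | IsCoherentAlgebra S ∧ G.adjMatrix ℂ ∈ S}

/-- The coherent closure is itself a coherent algebra. -/
theorem isCoherentAlgebra_coherentClosure {V : Type*} [Fintype V] [DecidableEq V]
    (G : SimpleGraph V) : IsCoherentAlgebra (coherentClosure G) where
  allOnes_mem := Algebra.mem_sInf.2 fun _ hS => hS.1.allOnes_mem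
  transpose_mem M hM := Algebra.mem_sInf.2 fun S hS =>
    hS.1.transpose_mem M (Algebra.mem_sInf.1 hM S hS)
  hadamard_mem M hM N hN := Algebra.mem_sInf.2 fun S hS =>
    hS.1.hadamard_mem M (Algebra.mem_sInf.1 hM S hS) N (Algebra.mem_sInf.1 hN S hS)

/-- The rank of the coherent closure: the number of members of its basis of `{0,1}`-matrices,
that is, its dimension. -/
noncomputable def coherentRank {V : Type*} [Fintype V] [DecidableEq V] (G : SimpleGraph V) : ℕ :=
  Module.finrank ℂ (coherentClosure G)

/-! Let A be the adjacency matrix of the cone, with cells apex, points and blocks. The target is (A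
− θ₁)(A − θ₂) = w wᵀ with w positive and constant on cells. By
`realEigenvalues_eq_of_quadratic_eq_vecMulVec`, A then has exactly three eigenvalues, the largest
belonging to w; as w is constant on cells, it is also the largest eigenvalue of the 3 × 3 quotient.

The design identities make all products of M, Mᵀ and X explicit. The conditions on x, y, λ and MX
cancel every non-constant term of the quadratic (`coneMatrix_quadratic`), leaving one constant per
pair of cells. The square-root equations say that the off-diagonal constants are geometric means of
the diagonal ones, which is rank one once the diagonal constants are positive (`inG3_coneGraph`). A
weight ε ∈ {0, 1} between points treats both graphs at once.

For the coherent rank, ordered pairs of vertices fall into fourteen classes whose span is closed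
under products by the same identities (`mul_eq_coneColour`). Conversely, if the three degrees
differ, the diagonal of A² separates the cells, and cutting J and A by the cell projections recovers
all fourteen classes (`coneAlgebra_le`). -/

/-! ### Incidence and Gram matrix identities -/

/-- The points-by-blocks incidence matrix. -/
def incMatrix (R : Type*) [Zero R] [One R] {P B : Type*} [DecidableEq P] (blk : B → Finset P) :
    Matrix P B R :=
  Matrix.of fun p j => if p ∈ blk j then 1 else 0

/-- The Gram matrix of the blocks: its entries are the block intersection numbers. -/
def gramMatrix (R : Type*) [NatCast R] {P B : Type*} [DecidableEq P] (blk : B → Finset P) :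
    Matrix B B R :=
  Matrix.of fun i j => ((blk i ∩ blk j).card : R)

/-- Cell blocks of the matrices below are combinations of J and at most two others; this expands an
entry of a product of two such blocks into sums that are known. -/
theorem sum_three_mul_three {ι R : Type*} [Fintype ι] [CommSemiring R] (f f' g g' : ι → R)
    (c d e c' d' e' : R) :
    ∑ m, (c + d * f m + e * f' m) * (c' + d' * g m + e' * g' m) =
      Fintype.card ι * (c * c') + c * d' * ∑ m, g m + c * e' * ∑ m, g' m
      + d * c' * ∑ m, f m + d * d' * ∑ m, f m * g m + d * e' * ∑ m, f m * g' m
      + e * c' * ∑ m, f' m + e * d' * ∑ m, f' m * g m + e * e' * ∑ m, f' m * g' m := by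
  have h : (Fintype.card ι : R) * (c * c') = ∑ _m : ι, c * c' := by simp
  rw [h]
  simp only [Finset.mul_sum, ← Finset.sum_add_distrib]
  exact Finset.sum_congr rfl fun m _ => by ring

theorem sum_inc_mul_inc_points (R : Type*) [CommRing R] {P B : Type*} [Fintype P]
    [DecidableEq P] (blk : B → Finset P) (i j : B) :
    ∑ p, incMatrix R blk p i * incMatrix R blk p j = gramMatrix R blk i j := by
  simp only [incMatrix, gramMatrix, Matrix.of_apply, ← ite_and, mul_ite, mul_one, mul_zero,
    Finset.sum_boole]
  congr 2
  ext p
  simp [and_comm]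

theorem gramMatrix_comm (R : Type*) [NatCast R] {P B : Type*} [DecidableEq P] (blk : B → Finset P)
    (i j : B) : gramMatrix R blk i j = gramMatrix R blk j i := by
  simp [gramMatrix, Finset.inter_comm]

theorem blockGraph_adj {P B : Type*} [DecidableEq P] {blk : B → Finset P} {x : ℕ} {i j : B} :
    (blockGraph blk x).Adj i j ↔ i ≠ j ∧ (blk i ∩ blk j).card = x :=
  Iff.rfl

namespace IsQSD

variable {P B : Type*} [Fintype P] [DecidableEq P] [Fintype B]
  {blk : B → Finset P} {v k lam b r x y : ℕ}

/-- Otherwise every block is the whole point set and only one intersection size occurs. -/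
theorem k_lt_v (hQ : IsQSD blk v k lam b r x y) : k < v := by
  by_contra! h
  have hu : ∀ j, blk j = Finset.univ := fun j =>
    Finset.eq_univ_of_card _ (le_antisymm (Finset.card_le_univ _)
      (by rw [hQ.block_card, hQ.card_points]; exact h))
  obtain ⟨i, j, -, hij⟩ := hQ.x_occurs
  obtain ⟨i', j', -, hij'⟩ := hQ.y_occurs
  exact hQ.x_ne_y (by rw [← hij, ← hij']; simp only [hu])

theorem exists_points_ne (hQ : IsQSD blk v k lam b r x y) : ∃ p q : P, p ≠ q := by
  have := hQ.k_lt_v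
  have h1 := hQ.one_le_k
  exact Fintype.one_lt_card_iff.1 (by rw [hQ.card_points]; omega)

theorem exists_mem (hQ : IsQSD blk v k lam b r x y) (j : B) : ∃ p, p ∈ blk j :=
  Finset.card_pos.1 (by rw [hQ.block_card]; exact hQ.one_le_k)

theorem exists_notMem (hQ : IsQSD blk v k lam b r x y) (j : B) : ∃ p, p ∉ blk j := by
  by_contra! h
  have := hQ.k_lt_v
  rw [← hQ.block_card j, Finset.eq_univ_iff_forall.2 h, Finset.card_univ, hQ.card_points] at this
  exact lt_irrefl _ this

theorem one_le_r (hQ : IsQSD blk v k lam b r x y) : 1 ≤ r := by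
  obtain ⟨j, -⟩ := hQ.x_occurs
  obtain ⟨p, hp⟩ := hQ.exists_mem j
  rw [← hQ.point_replication p]
  exact Finset.card_pos.2 ⟨j, by simpa using hp⟩

theorem r_le_b (hQ : IsQSD blk v k lam b r x y) : r ≤ b := by
  obtain ⟨p, -⟩ := hQ.exists_points_ne
  rw [← hQ.point_replication p, ← hQ.card_blocks]
  exact Finset.card_le_univ _

section Sums

variable (R : Type*) [CommRing R]

theorem sum_inc_points (hQ : IsQSD blk v k lam b r x y) (j : B) :
    ∑ p, incMatrix R blk p j = k := by
  simp [incMatrix, hQ.block_card]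

theorem sum_inc_blocks (hQ : IsQSD blk v k lam b r x y) (p : P) :
    ∑ j, incMatrix R blk p j = r := by
  simp [incMatrix, hQ.point_replication]

theorem sum_inc_mul_inc_blocks (hQ : IsQSD blk v k lam b r x y) (p q : P) :
    ∑ j, incMatrix R blk p j * incMatrix R blk q j =
      lam + (r - lam) * (1 : Matrix P P R) p q := by
  simp only [incMatrix, Matrix.of_apply, ← ite_and, mul_ite, mul_one, mul_zero]
  rcases eq_or_ne p q with rfl | h
  · simp [hQ.point_replication]
  · simp only [Matrix.one_apply_ne h, mul_zero, add_zero, ← hQ.pair_replication p q h,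
      Finset.sum_boole, and_comm]

theorem sum_gram (hQ : IsQSD blk v k lam b r x y) (i : B) :
    ∑ j, gramMatrix R blk i j = k * r := by
  simp_rw [← sum_inc_mul_inc_points R blk]
  rw [Finset.sum_comm]
  simp_rw [← Finset.mul_sum, hQ.sum_inc_blocks R, ← Finset.sum_mul, hQ.sum_inc_points R]

/-- Associativity: M(MᵀM) = (MMᵀ)M, and MMᵀ is a combination of I and J. -/
theorem sum_inc_mul_gram (hQ : IsQSD blk v k lam b r x y) (p : P) (i : B) :
    ∑ j, incMatrix R blk p j * gramMatrix R blk j i =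
      lam * k + (r - lam) * incMatrix R blk p i := by
  simp_rw [← sum_inc_mul_inc_points R, Finset.mul_sum]
  rw [Finset.sum_comm]
  simp_rw [← mul_assoc, ← Finset.sum_mul, hQ.sum_inc_mul_inc_blocks R, add_mul,
    Finset.sum_add_distrib, ← Finset.mul_sum, hQ.sum_inc_points R, mul_assoc, ← Finset.mul_sum]
  simp [Matrix.one_apply]

theorem sum_gram_mul_gram (hQ : IsQSD blk v k lam b r x y) (i j : B) :
    ∑ l, gramMatrix R blk i l * gramMatrix R blk l j =
      lam * k * k + (r - lam) * gramMatrix R blk i j := by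
  have h : ∀ l, gramMatrix R blk i l * gramMatrix R blk l j =
      ∑ p, incMatrix R blk p i * (incMatrix R blk p l * gramMatrix R blk l j) := fun l => by
    rw [← sum_inc_mul_inc_points R blk i l, Finset.sum_mul]
    simp_rw [mul_assoc]
  simp_rw [h]
  rw [Finset.sum_comm]
  simp_rw [← Finset.mul_sum, hQ.sum_inc_mul_gram R, mul_add, Finset.sum_add_distrib,
    ← Finset.sum_mul, hQ.sum_inc_points R, ← sum_inc_mul_inc_points R blk i j, Finset.mul_sum]
  congr 1
  · ring
  · exact Finset.sum_congr rfl fun _ _ => by ring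

end Sums

/-- Two points are avoided by `b - 2r + λ` blocks. -/
theorem two_mul_r_le (hQ : IsQSD blk v k lam b r x y) : 2 * (r : ℝ) ≤ b + lam := by
  obtain ⟨p, q, hpq⟩ := hQ.exists_points_ne
  have h : ∑ j, (1 - incMatrix ℝ blk p j) * (1 - incMatrix ℝ blk q j) = b + lam - 2 * r := by
    simp only [mul_sub, sub_mul, mul_one, one_mul, Finset.sum_sub_distrib, hQ.sum_inc_blocks ℝ,
      hQ.sum_inc_mul_inc_blocks ℝ, Matrix.one_apply_ne hpq]
    simp [hQ.card_blocks]
    ring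
  have h0 : 0 ≤ ∑ j, (1 - incMatrix ℝ blk p j) * (1 - incMatrix ℝ blk q j) :=
    Finset.sum_nonneg fun j _ => by
      simp only [incMatrix, Matrix.of_apply]
      split_ifs <;> simp
  linarith

theorem cast_x_sub_y_ne_zero (K : Type*) [Field K] [CharZero K] (hQ : IsQSD blk v k lam b r x y) :
    (x : K) - y ≠ 0 :=
  sub_ne_zero.2 (Nat.cast_injective.ne hQ.x_ne_y)

/-- Since x ≠ y, this can be solved for X, turning identities of the Gram matrix into identities of
the block graph. -/
theorem gram_eq (R : Type*) [CommRing R] [DecidableEq B] [DecidableRel (blockGraph blk x).Adj]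
    (hQ : IsQSD blk v k lam b r x y) (i j : B) :
    gramMatrix R blk i j = y + (k - y) * (1 : Matrix B B R) i j +
      (x - y) * (blockGraph blk x).adjMatrix R i j := by
  rcases eq_or_ne i j with rfl | h
  · simp [gramMatrix, hQ.block_card]
  · have hxy := hQ.x_ne_y
    rcases hQ.inter_card i j h with h' | h'
    · simp [gramMatrix, h', h, SimpleGraph.adjMatrix_apply, blockGraph_adj]
    · simp [gramMatrix, h', h, SimpleGraph.adjMatrix_apply, blockGraph_adj, hxy.symm]

end IsQSD

/-! ### Three eigenvalues from a rank-one quadratic -/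

section Spectrum

variable {n : Type*} [Fintype n] [DecidableEq n]

theorem mem_realEigenvalues_iff {A : Matrix n n ℝ} {μ : ℝ} :
    μ ∈ realEigenvalues A ↔ ∃ z : n → ℝ, z ≠ 0 ∧ A.mulVec z = μ • z := by
  constructor
  · intro h
    obtain ⟨z, hz⟩ := Module.End.HasEigenvalue.exists_hasEigenvector h
    exact ⟨z, hz.2, by simpa using hz.apply_eq_smul⟩
  · rintro ⟨z, h0, hz⟩
    exact Module.End.hasEigenvalue_of_hasEigenvector
      (x := z) ⟨Module.End.mem_eigenspace_iff.2 (by simpa using hz), h0⟩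

/-- An eigenvalue of a nonnegative matrix with zero diagonal and constant row sums is at most
the row sum. -/
theorem le_rowSum_of_mem_realEigenvalues {A : Matrix n n ℝ} {d μ : ℝ} (h0 : ∀ i j, 0 ≤ A i j)
    (hdiag : ∀ i, A i i = 0) (hd : ∀ i, ∑ j, A i j = d) (hμ : μ ∈ realEigenvalues A) : μ ≤ d := by
  -- Gershgorin: the disc is centred at a diagonal entry, here 0.
  obtain ⟨i, hi⟩ := eigenvalue_mem_ball hμ
  rw [hdiag, mem_closedBall_zero_iff] at hi
  calc μ ≤ ‖μ‖ := Real.le_norm_self μ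
    _ ≤ _ := hi
    _ = ∑ j ∈ Finset.univ.erase i, A i j :=
        Finset.sum_congr rfl fun j _ => by rw [Real.norm_of_nonneg (h0 i j)]
    _ = d := by rw [Finset.sum_erase _ (hdiag i), hd]

theorem eq_zero_of_mulVec_eq_smul_of_notMem {A : Matrix n n ℝ} {μ : ℝ}
    (h : μ ∉ realEigenvalues A) {z : n → ℝ} (hz : A.mulVec z = μ • z) : z = 0 := by
  by_contra h0
  exact h (mem_realEigenvalues_iff.2 ⟨z, h0, hz⟩)

/-- If `(A - θ₁)(A - θ₂) = w wᵀ` with `w` entrywise positive and `A` a symmetric matrix with zero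
diagonal and entries in `[0, 1]`, then `A` has precisely three eigenvalues. -/
theorem realEigenvalues_eq_of_quadratic_eq_vecMulVec [Nontrivial n] {A : Matrix n n ℝ}
    {θ₁ θ₂ : ℝ} {w : n → ℝ} (hθ₁ : 0 < θ₁) (hθ₂ : θ₂ < -1) (hA : A.IsSymm)
    (h0 : ∀ i j, 0 ≤ A i j) (h1 : ∀ i j, A i j ≤ 1) (hdiag : ∀ i, A i i = 0)
    (hw : ∀ i, 0 < w i)
    (hq : A * A - (θ₁ + θ₂) • A + (θ₁ * θ₂) • (1 : Matrix n n ℝ) = Matrix.vecMulVec w w) :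
    ∃ θ₀, θ₁ < θ₀ ∧ A.mulVec w = θ₀ • w ∧ realEigenvalues A = {θ₀, θ₁, θ₂} := by
  have hww : 0 < dotProduct w w :=
    Finset.sum_pos (fun i _ => mul_pos (hw i) (hw i)) Finset.univ_nonempty
  have hcomm : A * Matrix.vecMulVec w w = Matrix.vecMulVec w w * A := by
    rw [← hq]; noncomm_ring
  -- A commutes with w wᵀ, a polynomial in A, so A preserves the line of w; the eigenvalue is the
  -- Rayleigh quotient.
  have hAw : A.mulVec w = (dotProduct w (A.mulVec w) / dotProduct w w) • w := by
    have h := congrArg (fun N => N.mulVec w) hcomm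
    simp only [← Matrix.mulVec_mulVec, Matrix.vecMulVec_mulVec] at h
    funext i
    have hi := congrFun h i
    simp [Matrix.mulVec_smul] at hi
    simp only [Pi.smul_apply, smul_eq_mul]
    field_simp
    linarith
  set θ₀ := dotProduct w (A.mulVec w) / dotProduct w w with hθ₀
  have hθ₀0 : 0 ≤ θ₀ := div_nonneg (Finset.sum_nonneg fun i _ => mul_nonneg (hw i).le
    (Finset.sum_nonneg fun j _ => mul_nonneg (h0 i j) (hw j).le)) hww.le
  -- action of the quadratic on an eigenvector
  have key : ∀ (μ : ℝ) (z : n → ℝ), A.mulVec z = μ • z →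
      ((μ - θ₁) * (μ - θ₂)) • z = dotProduct w z • w := by
    intro μ z hz
    have h := congrArg (fun N => N.mulVec z) hq
    simp only [Matrix.add_mulVec, Matrix.sub_mulVec, ← Matrix.mulVec_mulVec, Matrix.smul_mulVec,
      Matrix.one_mulVec, hz, Matrix.mulVec_smul, Matrix.vecMulVec_mulVec] at h
    funext i
    have hi := congrFun h i
    simp at hi ⊢
    linarith
  have hkw : (θ₀ - θ₁) * (θ₀ - θ₂) = dotProduct w w := by
    obtain ⟨i⟩ : Nonempty n := inferInstance
    have := congrFun (key θ₀ w hAw) i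
    simp only [Pi.smul_apply, smul_eq_mul] at this
    exact mul_right_cancel₀ (hw i).ne' this
  have hpos : 0 < θ₀ - θ₂ := by linarith
  have hθ₀₁ : 0 < θ₀ - θ₁ := by
    by_contra! h
    have := mul_nonpos_of_nonpos_of_nonneg h hpos.le
    linarith
  have hw0 : w ≠ 0 := by
    intro h
    obtain ⟨i⟩ : Nonempty n := inferInstance
    exact (hw i).ne' (congrFun h i)
  -- if one of the two roots is not an eigenvalue, then `A` is explicit
  have expl : ∀ α β : ℝ, α + β = θ₁ + θ₂ → α * β = θ₁ * θ₂ → α ∉ realEigenvalues A →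
      ∀ i j, (θ₀ - α) * (A i j - β * (1 : Matrix n n ℝ) i j) = w i * w j := by
    intro α β hs hp hα i j
    -- A − α annihilates (θ₀ − α)(A − β) − w wᵀ, both terms becoming (θ₀ − α) w wᵀ; as A − α is
    -- injective, the matrix itself vanishes.
    have hz : A.mulVec (fun i => (θ₀ - α) * (A i j - β * (1 : Matrix n n ℝ) i j) - w i * w j) =
        α • (fun i => (θ₀ - α) * (A i j - β * (1 : Matrix n n ℝ) i j) - w i * w j) := by
      funext i
      have h2 : ∑ l, A i l * A l j - (θ₁ + θ₂) * A i j + θ₁ * θ₂ * (1 : Matrix n n ℝ) i j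
          = w i * w j := by
        have := congrFun (congrFun hq i) j
        simpa [Matrix.mul_apply, Matrix.vecMulVec_apply] using this
      have h3 : ∑ l, A i l * (1 : Matrix n n ℝ) l j = A i j := by
        simp [Matrix.one_apply]
      have h4 : ∑ l, A i l * w l = θ₀ * w i := by
        simpa [Matrix.mulVec, dotProduct] using congrFun hAw i
      have h5 : ∑ l, A i l * ((θ₀ - α) * (A l j - β * (1 : Matrix n n ℝ) l j) - w l * w j) =
          (θ₀ - α) * (∑ l, A i l * A l j - β * ∑ l, A i l * (1 : Matrix n n ℝ) l j)
            - (∑ l, A i l * w l) * w j := by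
        simp only [Finset.mul_sum, Finset.sum_mul, ← Finset.sum_sub_distrib]
        exact Finset.sum_congr rfl fun l _ => by ring
      simp only [Matrix.mulVec, dotProduct, Pi.smul_apply, smul_eq_mul]
      rw [h5, h3, h4]
      rw [← hs, ← hp] at h2
      linear_combination (θ₀ - α) * h2
    exact sub_eq_zero.1 (congrFun (eq_zero_of_mulVec_eq_smul_of_notMem hα hz) i)
  have hm₁ : θ₁ ∈ realEigenvalues A := by
    by_contra h
    have he := expl θ₁ θ₂ rfl rfl h
    obtain ⟨i, j, hij⟩ := exists_pair_ne n
    have hii := he i i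
    have hjj := he j j
    have hij' := he i j
    simp only [Matrix.one_apply_eq, Matrix.one_apply_ne hij, hdiag] at hii hjj hij'
    have hij1 := h1 i j
    -- The diagonal gives w i ² = −(θ₀ − θ₁)θ₂ for all i, so w is constant and off-diagonal entries
    -- would equal −θ₂ > 1.
    have hsq : w i = w j := by
      nlinarith [hw i, hw j, sq_nonneg (w i - w j)]
    rw [← hsq] at hij'
    have : A i j = -θ₂ := by
      apply mul_left_cancel₀ hθ₀₁.ne'
      linarith
    linarith
  have hm₂ : θ₂ ∈ realEigenvalues A := by
    by_contra h
    obtain ⟨i⟩ : Nonempty n := inferInstance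
    -- Here the diagonal would make w i ² equal to −(θ₀ − θ₂)θ₁ < 0.
    have hii := expl θ₂ θ₁ (add_comm _ _) (mul_comm _ _) h i i
    rw [hdiag, Matrix.one_apply_eq] at hii
    nlinarith [mul_pos (hw i) (hw i), mul_pos hpos hθ₁]
  refine ⟨θ₀, by linarith, hAw, Set.ext fun μ => ⟨fun hμ => ?_, ?_⟩⟩
  · obtain ⟨z, hz0, hz⟩ := mem_realEigenvalues_iff.1 hμ
    by_cases hμ₀ : μ = θ₀
    · simp [hμ₀]
    have horth : dotProduct w z = 0 := by
      have h1 : dotProduct w (A.mulVec z) = dotProduct (A.mulVec w) z := by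
        rw [Matrix.dotProduct_mulVec, ← Matrix.mulVec_transpose, hA.eq]
      rw [hz, hAw, dotProduct_smul, smul_dotProduct, smul_eq_mul, smul_eq_mul] at h1
      exact (mul_eq_mul_right_iff.1 h1).resolve_left hμ₀
    have hk := key μ z hz
    rw [horth, zero_smul] at hk
    rcases mul_eq_zero.1 ((smul_eq_zero.1 hk).resolve_right hz0) with h | h
    · simp [sub_eq_zero.1 h]
    · simp [sub_eq_zero.1 h]
  · rintro (rfl | rfl | rfl)
    · exact mem_realEigenvalues_iff.2 ⟨w, hw0, hAw⟩
    · exact hm₁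
    · exact hm₂

end Spectrum

/-! ### Spectrum of the block graph -/

namespace IsQSD

variable {P B : Type*} [Fintype P] [DecidableEq P] [Fintype B] [DecidableEq B]
  {blk : B → Finset P} {v k lam b r x y : ℕ}

theorem sum_blockGraph_adjMatrix [DecidableRel (blockGraph blk x).Adj]
    (hQ : IsQSD blk v k lam b r x y) (i : B) :
    ∑ j, (blockGraph blk x).adjMatrix ℝ i j = (k * r - y * b - (k - y)) / (x - y) := by
  have hne := hQ.cast_x_sub_y_ne_zero ℝ
  have h := hQ.sum_gram ℝ i
  simp_rw [hQ.gram_eq ℝ, Finset.sum_add_distrib, ← Finset.mul_sum] at h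
  simp only [Finset.sum_const, Finset.card_univ, hQ.card_blocks, Matrix.one_apply,
    Finset.sum_ite_eq, Finset.mem_univ, if_true, nsmul_eq_mul] at h
  rw [eq_div_iff hne]
  linarith

/-- The spectral data of the block graph of a quasi-symmetric design. -/
theorem blockGraph_spectrum (hQ : IsQSD blk v k lam b r x y) {e₀ e₁ e₂ : ℝ}
    (hB : InG3 (blockGraph blk x) e₀ e₁ e₂) :
    e₀ = (k * r - y * b - (k - y)) / (x - y) ∧
    e₁ + e₂ = (r - lam + y - k) / (x - y) + (y - k) / (x - y) ∧
    e₁ * e₂ = (r - lam + y - k) / (x - y) * ((y - k) / (x - y)) := by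
  classical
  obtain ⟨-, h01, h12, hspec⟩ := hB
  have hne := hQ.cast_x_sub_y_ne_zero ℝ
  set X := (blockGraph blk x).adjMatrix ℝ with hX
  have hspec' : realEigenvalues X = {e₀, e₁, e₂} := by
    rw [hX]; convert hspec
  have hrow : ∀ i, ∑ j, X i j = (k * r - y * b - (k - y)) / (x - y) := by
    intro i
    rw [← hQ.sum_blockGraph_adjMatrix i, hX]
  set d : ℝ := (k * r - y * b - (k - y)) / (x - y) with hd
  have hle : ∀ μ ∈ realEigenvalues X, μ ≤ d := fun μ hμ =>
    le_rowSum_of_mem_realEigenvalues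
      (fun i j => by rw [hX, SimpleGraph.adjMatrix_apply]; split_ifs <;> simp)
      (fun i => by simp [hX]) hrow hμ
  obtain ⟨i₀, -⟩ := hQ.x_occurs
  have hmem : d ∈ realEigenvalues X := by
    refine mem_realEigenvalues_iff.2 ⟨fun _ => 1, fun h => one_ne_zero (congrFun h i₀), ?_⟩
    funext i
    simpa [Matrix.mulVec, dotProduct] using hrow i
  have he₀ : e₀ = d := by
    have h1 := hle e₀ (by simp [hspec'])
    rw [hspec'] at hmem
    rcases hmem with h | h | h
    · exact h.symm
    · linarith
    · rw [Set.mem_singleton_iff] at h; linarith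
  set α : ℝ := (r - lam + y - k) / (x - y) with hα
  set β : ℝ := (y - k) / (x - y) with hβ
  -- An eigenvector for e ≠ d sums to zero, so J kills it. The Gram matrix G acts on it as (k − y) +
  -- (x − y)e, and G² = (r − λ)G + λk²J leaves two values for e.
  have hroot : ∀ e ∈ realEigenvalues X, e ≠ d → (e - α) * (e - β) = 0 := by
    intro e he hed
    obtain ⟨z, hz0, hz⟩ := mem_realEigenvalues_iff.1 he
    have hz' : ∀ i, ∑ j, X i j * z j = e * z i := fun i => by
      simpa [Matrix.mulVec, dotProduct] using congrFun hz i
    have hsym : ∀ i j, X i j = X j i := fun i j => by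
      simp [hX, SimpleGraph.adjMatrix_apply, SimpleGraph.adj_comm]
    have hsum : ∑ i, z i = 0 := by
      have h1 : ∑ i, ∑ j, X i j * z j = d * ∑ j, z j := by
        rw [Finset.sum_comm, Finset.mul_sum]
        refine Finset.sum_congr rfl fun j _ => ?_
        rw [← Finset.sum_mul, ← hrow j]
        simp_rw [hsym _ j]
      simp_rw [hz', ← Finset.mul_sum] at h1
      exact (mul_eq_mul_right_iff.1 h1).resolve_left hed
    have hG : ∀ i, ∑ j, gramMatrix ℝ blk i j * z j = ((k - y) + (x - y) * e) * z i := by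
      intro i
      simp_rw [hQ.gram_eq ℝ, add_mul, Finset.sum_add_distrib, mul_assoc, ← Finset.mul_sum, hsum]
      have : ∑ j, (blockGraph blk x).adjMatrix ℝ i j * z j = e * z i := hz' i
      rw [this]
      simp [Matrix.one_apply]
    have hGG : ∀ i, ∑ l, gramMatrix ℝ blk i l * ∑ j, gramMatrix ℝ blk l j * z j =
        (r - lam) * ∑ j, gramMatrix ℝ blk i j * z j := by
      intro i
      simp_rw [Finset.mul_sum]
      rw [Finset.sum_comm]
      simp_rw [← mul_assoc, ← Finset.sum_mul, hQ.sum_gram_mul_gram ℝ, add_mul,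
        Finset.sum_add_distrib, ← Finset.mul_sum, hsum]
      simp
    obtain ⟨i, hi⟩ := Function.ne_iff.1 hz0
    have h := hGG i
    simp_rw [hG] at h
    have hc : ∀ c : ℝ, ∑ l, gramMatrix ℝ blk i l * (c * z l) =
        c * ∑ l, gramMatrix ℝ blk i l * z l := fun c => by
      rw [Finset.mul_sum]
      exact Finset.sum_congr rfl fun l _ => by ring
    rw [hc, hG] at h
    have h' : (((k : ℝ) - y) + (x - y) * e) * (((k - y) + (x - y) * e) - (r - lam)) = 0 := by
      apply mul_right_cancel₀ hi
      linear_combination h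
    have h1 : ((k : ℝ) - y) + (x - y) * e = (x - y) * (e - β) := by
      rw [hβ]; field_simp; ring
    have h2 : (((k : ℝ) - y) + (x - y) * e) - (r - lam) = (x - y) * (e - α) := by
      rw [hα]; field_simp; ring
    rw [h2, h1] at h'
    have h3 : ((x : ℝ) - y) ^ 2 * ((e - α) * (e - β)) = 0 := by linear_combination h'
    exact (mul_eq_zero.1 h3).resolve_left (pow_ne_zero 2 hne)
  have r1 := hroot e₁ (by simp [hspec']) (by linarith)
  have r2 := hroot e₂ (by simp [hspec']) (by linarith)
  have hsum : e₁ + e₂ = α + β := by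
    have : (e₁ - e₂) * (e₁ + e₂ - (α + β)) = 0 := by linear_combination r1 - r2
    have := (mul_eq_zero.1 this).resolve_left (by linarith)
    linarith
  refine ⟨he₀, hsum, ?_⟩
  have : e₂ = α + β - e₁ := by linarith
  rw [this]
  linear_combination (-1 : ℝ) * r1

end IsQSD

/-! ### Products involving the block graph -/

namespace IsQSD

variable {P B : Type*} [Fintype P] [DecidableEq P] [Fintype B] [DecidableEq B]
  {blk : B → Finset P} {v k lam b r x y : ℕ} [DecidableRel (blockGraph blk x).Adj]

theorem adjMatrix_blockGraph_eq (hQ : IsQSD blk v k lam b r x y) (i j : B) :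
    (blockGraph blk x).adjMatrix ℝ i j =
      (gramMatrix ℝ blk i j - y - (k - y) * (1 : Matrix B B ℝ) i j) / (x - y) := by
  rw [eq_div_iff (hQ.cast_x_sub_y_ne_zero ℝ), hQ.gram_eq ℝ]
  ring

theorem sum_inc_mul_adjMatrix (hQ : IsQSD blk v k lam b r x y) (p : P) (i : B) :
    ∑ j, incMatrix ℝ blk p j * (blockGraph blk x).adjMatrix ℝ j i =
      (r - lam + y - k) / (x - y) * incMatrix ℝ blk p i + (lam * k - y * r) / (x - y) := by
  have hne := hQ.cast_x_sub_y_ne_zero ℝ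
  have h := hQ.sum_inc_mul_gram ℝ p i
  simp_rw [hQ.gram_eq ℝ, mul_add, Finset.sum_add_distrib, mul_left_comm (incMatrix ℝ blk p _),
    ← Finset.mul_sum, ← Finset.sum_mul, hQ.sum_inc_blocks ℝ] at h
  have h1 : ∑ j, incMatrix ℝ blk p j * (1 : Matrix B B ℝ) j i = incMatrix ℝ blk p i := by
    simp [Matrix.one_apply]
  rw [h1] at h
  field_simp
  linarith

theorem sum_adjMatrix_mul_adjMatrix (hQ : IsQSD blk v k lam b r x y) {e₀ e₁ e₂ : ℝ}
    (hB : InG3 (blockGraph blk x) e₀ e₁ e₂) (i j : B) :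
    ∑ l, (blockGraph blk x).adjMatrix ℝ i l * (blockGraph blk x).adjMatrix ℝ l j =
      (e₁ + e₂) * (blockGraph blk x).adjMatrix ℝ i j - e₁ * e₂ * (1 : Matrix B B ℝ) i j
        + (e₀ + e₁ * e₂) := by
  have hne := hQ.cast_x_sub_y_ne_zero ℝ
  obtain ⟨he₀, hs, hp⟩ := hQ.blockGraph_spectrum hB
  have key : ∀ i j, ∑ l, (blockGraph blk x).adjMatrix ℝ i l * (blockGraph blk x).adjMatrix ℝ l j =
      (e₁ + e₂) * (blockGraph blk x).adjMatrix ℝ i j - e₁ * e₂ * (1 : Matrix B B ℝ) i j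
        + (lam * k * k - 2 * y * (k * r) + 2 * (k - y) * y + b * y * y
          + (r - lam - 2 * (k - y)) * y) / (x - y) ^ 2 := by
    intro i j
    have h := sum_three_mul_three (fun l => (1 : Matrix B B ℝ) i l) (fun l => gramMatrix ℝ blk i l)
      (fun l => (1 : Matrix B B ℝ) l j) (fun l => gramMatrix ℝ blk l j)
      (-(y / (x - y))) (-((k - y) / (x - y))) (1 / (x - y))
      (-(y / (x - y))) (-((k - y) / (x - y))) (1 / ((x : ℝ) - y))
    have hcol : ∑ l, gramMatrix ℝ blk l j = k * r := by
      simp_rw [gramMatrix_comm ℝ blk _ j]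
      exact hQ.sum_gram ℝ j
    have h1 : ∑ l, (1 : Matrix B B ℝ) i l = 1 := by simp [Matrix.one_apply]
    have h2 : ∑ l, (1 : Matrix B B ℝ) l j = 1 := by simp [Matrix.one_apply]
    have h3 : ∀ F : B → ℝ, ∑ l, (1 : Matrix B B ℝ) i l * F l = F i := fun F => by
      simp [Matrix.one_apply]
    have h4 : ∀ F : B → ℝ, ∑ l, F l * (1 : Matrix B B ℝ) l j = F j := fun F => by
      simp [Matrix.one_apply]
    simp only [hQ.sum_gram ℝ, hcol, hQ.sum_gram_mul_gram ℝ, hQ.card_blocks, h1, h2, h3, h4] at h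
    have h' : ∀ l, (blockGraph blk x).adjMatrix ℝ i l * (blockGraph blk x).adjMatrix ℝ l j =
      (-(y / (x - y)) + (-((k - y) / (x - y))) * (1 : Matrix B B ℝ) i l
        + 1 / (x - y) * gramMatrix ℝ blk i l) *
      (-(y / (x - y)) + (-((k - y) / (x - y))) * (1 : Matrix B B ℝ) l j
        + 1 / (x - y) * gramMatrix ℝ blk l j) := fun l => by
      rw [hQ.adjMatrix_blockGraph_eq, hQ.adjMatrix_blockGraph_eq]
      ring
    simp_rw [h']
    rw [h, hs, hp, hQ.gram_eq ℝ]
    field_simp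
    ring
  -- The diagonal of X² is the valency e₀, which identifies the constant in `key` as e₀ + e₁e₂.
  have hd := key i i
  have h1 : ∑ l, (blockGraph blk x).adjMatrix ℝ i l * (blockGraph blk x).adjMatrix ℝ l i = e₀ := by
    rw [he₀, ← hQ.sum_blockGraph_adjMatrix i]
    refine Finset.sum_congr rfl fun l _ => ?_
    simp [SimpleGraph.adjMatrix_apply, SimpleGraph.adj_comm]
  rw [h1] at hd
  simp only [SimpleGraph.adjMatrix_apply, SimpleGraph.irrefl, if_false, Matrix.one_apply_eq] at hd
  rw [key i j]
  linarith

/-- Row sums of X² give b(e₀ + e₁e₂) = (e₀ − e₁)(e₀ − e₂). This makes the block-block constant of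
the quadratic positive. -/
theorem e₀_add_mul_pos (hQ : IsQSD blk v k lam b r x y) {e₀ e₁ e₂ : ℝ}
    (hB : InG3 (blockGraph blk x) e₀ e₁ e₂) : 0 < e₀ + e₁ * e₂ := by
  have hrow : ∀ i, ∑ j, (blockGraph blk x).adjMatrix ℝ i j = e₀ := fun i => by
    rw [hQ.sum_blockGraph_adjMatrix i, (hQ.blockGraph_spectrum hB).1]
  obtain ⟨i, -⟩ := hQ.x_occurs
  have h : ∑ j, ∑ l, (blockGraph blk x).adjMatrix ℝ i l * (blockGraph blk x).adjMatrix ℝ l j =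
      e₀ * e₀ := by
    rw [Finset.sum_comm]
    simp_rw [← Finset.mul_sum, hrow, ← Finset.sum_mul, hrow]
  simp_rw [hQ.sum_adjMatrix_mul_adjMatrix hB, Finset.sum_add_distrib, Finset.sum_sub_distrib,
    ← Finset.mul_sum, hrow] at h
  simp [Matrix.one_apply, hQ.card_blocks] at h
  have h2 : b * (e₀ + e₁ * e₂) = (e₀ - e₁) * (e₀ - e₂) := by linear_combination h
  obtain ⟨-, h01, h12, -⟩ := hB
  have h3 : 0 < (e₀ - e₁) * (e₀ - e₂) := mul_pos (by linarith) (by linarith)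
  rw [← h2] at h3
  exact pos_of_mul_pos_right h3 (Nat.cast_nonneg b)

end IsQSD

/-! ### The cone matrix and its quadratic -/

section Cells

variable {P B : Type*}

/-- The adjacency matrix of the cone over a graph on points and blocks, where distinct points are
joined with weight `ε`. -/
def coneMatrix [DecidableEq P] (ε : ℝ) (M : Matrix P B ℝ) (X : Matrix B B ℝ) :
    Matrix (Option (P ⊕ B)) (Option (P ⊕ B)) ℝ
  | none, none => 0
  | none, some _ => 1
  | some _, none => 1
  | some (.inl p), some (.inl q) => ε * (1 - (1 : Matrix P P ℝ) p q)
  | some (.inl p), some (.inr j) => M p j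
  | some (.inr j), some (.inl p) => M p j
  | some (.inr i), some (.inr j) => X i j

/-- The vector that is constant on the apex, on the points and on the blocks. -/
def cellVec {R : Type*} (a p q : R) : Option (P ⊕ B) → R
  | none => a
  | some (.inl _) => p
  | some (.inr _) => q

/-- The symmetric matrix that is constant on pairs of cells. -/
def cellMatrix (a s t p u q : ℝ) : Matrix (Option (P ⊕ B)) (Option (P ⊕ B)) ℝ
  | none, none => a
  | none, some (.inl _) => s
  | none, some (.inr _) => t
  | some (.inl _), none => s
  | some (.inr _), none => t
  | some (.inl _), some (.inl _) => p
  | some (.inl _), some (.inr _) => u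
  | some (.inr _), some (.inl _) => u
  | some (.inr _), some (.inr _) => q

theorem adjMatrix_coneGraph_pointBlockGraph [DecidableEq P] (H : SimpleGraph P)
    (blk : B → Finset P) (x : ℕ) (ε : ℝ) [DecidableRel H.Adj] [DecidableRel (blockGraph blk x).Adj]
    [DecidableRel (coneGraph (pointBlockGraph H blk x)).Adj]
    (hH : ∀ p q, H.adjMatrix ℝ p q = ε * (1 - (1 : Matrix P P ℝ) p q)) :
    (coneGraph (pointBlockGraph H blk x)).adjMatrix ℝ =
      coneMatrix ε (incMatrix ℝ blk) ((blockGraph blk x).adjMatrix ℝ) := by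
  ext (_ | p | i) (_ | q | j)
  · simp [coneMatrix]
  · simp only [coneMatrix, SimpleGraph.adjMatrix_apply]
    exact if_pos trivial
  · simp only [coneMatrix, SimpleGraph.adjMatrix_apply]
    exact if_pos trivial
  · simp only [coneMatrix, SimpleGraph.adjMatrix_apply]
    exact if_pos trivial
  · simp only [coneMatrix, ← hH, SimpleGraph.adjMatrix_apply]
    exact if_congr Iff.rfl rfl rfl
  · simp only [coneMatrix, incMatrix, SimpleGraph.adjMatrix_apply]
    exact if_congr Iff.rfl rfl rfl
  · simp only [coneMatrix, SimpleGraph.adjMatrix_apply]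
    exact if_pos trivial
  · simp only [coneMatrix, incMatrix, SimpleGraph.adjMatrix_apply]
    exact if_congr Iff.rfl rfl rfl
  · simp only [coneMatrix, SimpleGraph.adjMatrix_apply]
    exact if_congr Iff.rfl rfl rfl

theorem coneGraph_connected {V : Type*} (G : SimpleGraph V) : (coneGraph G).Connected := by
  have h : ∀ s, (coneGraph G).Reachable none s := by
    rintro (_ | u)
    · exact SimpleGraph.Reachable.refl _
    · exact SimpleGraph.Adj.reachable (show (coneGraph G).Adj none (some u) from trivial)
  exact ⟨fun s t => (h s).symm.trans (h t)⟩

variable [Fintype P] [DecidableEq P] [Fintype B]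

theorem coneMatrix_mulVec_cellVec {v b k r : ℕ} {ε d : ℝ} {M : Matrix P B ℝ} {X : Matrix B B ℝ}
    (hv : Fintype.card P = v) (hb : Fintype.card B = b) (hk : ∀ j, ∑ p, M p j = k)
    (hr : ∀ p, ∑ j, M p j = r) (hd : ∀ i, ∑ j, X i j = d) (a p q : ℝ) :
    (coneMatrix ε M X).mulVec (cellVec a p q) =
      cellVec (v * p + b * q) (a + ε * (v - 1) * p + r * q) (a + k * p + d * q) := by
  funext i
  rcases i with _ | i | i
  · simp [Matrix.mulVec, dotProduct, coneMatrix, cellVec, Fintype.sum_option, hv, hb]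
  · simp [Matrix.mulVec, dotProduct, coneMatrix, cellVec, Fintype.sum_option, ← Finset.sum_mul,
      ← Finset.mul_sum, hr, Matrix.one_apply, hv]
    ring
  · simp [Matrix.mulVec, dotProduct, coneMatrix, cellVec, Fintype.sum_option, ← Finset.sum_mul,
      hk, hd]
    ring

variable [DecidableEq B]

/-- The quadratic `(A - θ₁)(A - θ₂)` of the cone matrix is constant on pairs of cells. -/
theorem coneMatrix_quadratic {v b k r lam y : ℕ} {ε d θ₁ θ₂ σ π c γ : ℝ} {M : Matrix P B ℝ}
    {X : Matrix B B ℝ} (hε : ε * ε = ε)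
    (hv : Fintype.card P = v) (hb : Fintype.card B = b) (hk : ∀ j, ∑ p, M p j = k)
    (hr : ∀ p, ∑ j, M p j = r) (hd : ∀ i, ∑ j, X i j = d) (hX : X.IsSymm)
    (hlam : (lam : ℝ) = r + θ₁ * θ₂ + ε * (θ₁ + θ₂ + 1))
    (hMM : ∀ p q, ∑ j, M p j * M q j = lam + (r - lam) * (1 : Matrix P P ℝ) p q)
    (hG : ∀ i j, ∑ p, M p i * M p j = y + (π - θ₁ * θ₂) * (1 : Matrix B B ℝ) i j +
      (θ₁ + θ₂ - σ) * X i j)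
    (hMX : ∀ p i, ∑ j, M p j * X j i = (θ₁ + θ₂ + ε) * M p i + c)
    (hXX : ∀ i j, ∑ l, X i l * X l j = σ * X i j - π * (1 : Matrix B B ℝ) i j + γ) :
    coneMatrix ε M X * coneMatrix ε M X - (θ₁ + θ₂) • coneMatrix ε M X
      + (θ₁ * θ₂) • (1 : Matrix (Option (P ⊕ B)) (Option (P ⊕ B)) ℝ) =
    cellMatrix (v + b + θ₁ * θ₂) (ε * (v - 1) + r - θ₁ - θ₂) (k + d - θ₁ - θ₂)
      (1 + ε * (v - 1) + r + θ₁ * θ₂) (1 + ε * k + c) (1 + y + γ) := by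
  have hd' : ∀ i, ∑ j, X j i = d := fun i => by
    rw [← hd i]
    exact Finset.sum_congr rfl fun j _ => hX.apply i j
  have hXM : ∀ p i, ∑ j, X i j * M p j = (θ₁ + θ₂ + ε) * M p i + c := fun p i => by
    rw [← hMX]
    exact Finset.sum_congr rfl fun j _ => by rw [hX.apply, mul_comm]
  have hIM : ∀ p i, ∑ q, (1 - (1 : Matrix P P ℝ) p q) * M q i = k - M p i := fun p i => by
    simp [sub_mul, Matrix.one_apply, hk]
  have hMI : ∀ p i, ∑ q, M q i * (1 - (1 : Matrix P P ℝ) q p) = k - M p i := fun p i => by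
    simp [mul_sub, Matrix.one_apply, hk]
  have hI : ∀ p, ∑ q, (1 - (1 : Matrix P P ℝ) p q) = v - 1 := fun p => by
    simp [Matrix.one_apply, hv]
  have hI' : ∀ p, ∑ q, (1 - (1 : Matrix P P ℝ) q p) = v - 1 := fun p => by
    simp [Matrix.one_apply, hv]
  have hII : ∀ p q, ∑ l, (1 - (1 : Matrix P P ℝ) p l) * (1 - (1 : Matrix P P ℝ) l q) =
      v - 2 + (1 : Matrix P P ℝ) p q := fun p q => by
    simp [mul_sub, Matrix.one_apply, hv]
    ring
  ext i j
  have hone : (1 : Matrix (Option (P ⊕ B)) (Option (P ⊕ B)) ℝ) i j = if i = j then 1 else 0 :=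
    Matrix.one_apply
  simp only [Matrix.add_apply, Matrix.sub_apply, Matrix.smul_apply, Matrix.mul_apply,
    Fintype.sum_option, Fintype.sum_sum_type, hone, smul_eq_mul]
  rcases i with _ | p | i <;> rcases j with _ | q | j <;>
    simp only [coneMatrix, cellMatrix, mul_one, one_mul, mul_zero, zero_add,
      Option.some.injEq, Sum.inl.injEq, Sum.inr.injEq, reduceCtorEq, if_true, if_false,
      mul_assoc ε, mul_left_comm _ ε, ← Finset.mul_sum, hI, hI', hr, hk, hd, hd', hMM, hG, hMX,
      hXX, hXM, hIM, hMI, hII, Finset.sum_const, Finset.card_univ, hv, hb, nsmul_eq_mul]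
  · ring
  · ring
  · ring
  · ring
  -- Point-point part: ε² = ε absorbs the square of ε(J − I), and the condition on λ makes
  -- off-diagonal and diagonal entries agree.
  · rw [← Matrix.one_apply]
    linear_combination (v - 2 + (1 : Matrix P P ℝ) p q) * hε
      + (1 - (1 : Matrix P P ℝ) p q) * hlam
  · ring
  · ring
  · ring
  · rw [← Matrix.one_apply]
    ring

end Cells

theorem vecMulVec_cellVec_sqrt {P B : Type*} {a p q : ℝ} (ha : 0 ≤ a) (hp : 0 ≤ p) (hq : 0 ≤ q) :
    Matrix.vecMulVec (cellVec (P := P) (B := B) √a √p √q) (cellVec √a √p √q) =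
      cellMatrix a √(a * p) √(a * q) p √(p * q) q := by
  ext (_ | i | i) (_ | j | j) <;>
    simp [Matrix.vecMulVec_apply, cellVec, cellMatrix, Real.sqrt_mul ha, Real.sqrt_mul hp, ha, hp,
      hq, mul_comm]

/-! ### Spectrum of the cone -/

namespace IsQSD

variable {P B : Type*} [Fintype P] [DecidableEq P] [Fintype B] [DecidableEq B]
  {blk : B → Finset P} {v k lam b r x y : ℕ}

theorem inG3_coneGraph (hQ : IsQSD blk v k lam b r x y) {e₀ e₁ e₂ θ₁ θ₂ ε : ℝ}
    (hB : InG3 (blockGraph blk x) e₀ e₁ e₂) (hθ₁ : 0 < θ₁) (hθ₂ : θ₂ < -1)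
    (hε : ε = 0 ∨ ε = 1) (H : SimpleGraph P) [DecidableRel H.Adj]
    (hH : ∀ p q, H.adjMatrix ℝ p q = ε * (1 - (1 : Matrix P P ℝ) p q))
    (hx : (x : ℝ) = k + (θ₁ + 1) * (θ₂ + 1) - (e₁ + 1) * (e₂ + 1))
    (hy : (y : ℝ) = k + θ₁ * θ₂ - e₁ * e₂)
    (hlam : (lam : ℝ) = r + θ₁ * θ₂ + ε * (θ₁ + θ₂ + 1))
    (hα : ((r : ℝ) - lam + y - k) / (x - y) = θ₁ + θ₂ + ε)
    (ha : (0 : ℝ) ≤ v + b + θ₁ * θ₂)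
    (h₁ : k + e₀ - θ₁ - θ₂ = √((v + b + θ₁ * θ₂) * (1 + k + e₀ + θ₁ * θ₂)))
    (h₂ : ε * (v - 1) + r - θ₁ - θ₂ = √((v + b + θ₁ * θ₂) * (1 + ε * (v - 1) + r + θ₁ * θ₂)))
    (h₃ : 1 + ε * k + ((lam : ℝ) * k - y * r) / (x - y) =
      √((1 + ε * (v - 1) + r + θ₁ * θ₂) * (1 + k + e₀ + θ₁ * θ₂))) :
    ∃ θ₀ : ℝ, IsGreatest (realEigenvalues !![0, (v : ℝ), b; 1, ε * (v - 1), r; 1, k, e₀]) θ₀ ∧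
      InG3 (coneGraph (pointBlockGraph H blk x)) θ₀ θ₁ θ₂ := by
  classical
  obtain ⟨p₀, -⟩ := hQ.exists_points_ne
  obtain ⟨j₀, -⟩ := hQ.x_occurs
  have hv0 : (0 : ℝ) < v := Nat.cast_pos.2 (lt_of_le_of_lt (Nat.zero_le k) hQ.k_lt_v)
  have hb0 : (0 : ℝ) < b := Nat.cast_pos.2 (lt_of_lt_of_le hQ.one_le_r hQ.r_le_b)
  have hr0 : (0 : ℝ) < r := Nat.cast_pos.2 hQ.one_le_r
  have hγ := hQ.e₀_add_mul_pos hB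
  have hrow : ∀ i, ∑ j, (blockGraph blk x).adjMatrix ℝ i j = e₀ := fun i => by
    rw [hQ.sum_blockGraph_adjMatrix i, (hQ.blockGraph_spectrum hB).1]
  have hquad := coneMatrix_quadratic (θ₁ := θ₁) (θ₂ := θ₂) (M := incMatrix ℝ blk)
    (X := (blockGraph blk x).adjMatrix ℝ) (ε := ε) (π := e₁ * e₂) (σ := e₁ + e₂) (lam := lam)
    (y := y)
    (by rcases hε with rfl | rfl <;> norm_num) hQ.card_points hQ.card_blocks
    (hQ.sum_inc_points ℝ) (hQ.sum_inc_blocks ℝ) hrow (SimpleGraph.isSymm_adjMatrix _) hlam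
    (hQ.sum_inc_mul_inc_blocks ℝ)
    -- The prescribed x and y amount to k − y = e₁e₂ − θ₁θ₂ and x − y = θ₁ + θ₂ − e₁ − e₂, exactly
    -- what cancels I and X in the block-block part.
    (fun i j => by
      rw [sum_inc_mul_inc_points, hQ.gram_eq ℝ, show (x : ℝ) - y = θ₁ + θ₂ - (e₁ + e₂) by
        rw [hx, hy]; ring, show (k : ℝ) - y = e₁ * e₂ - θ₁ * θ₂ by rw [hy]; ring])
    (fun p i => by rw [hQ.sum_inc_mul_adjMatrix, hα])
    (hQ.sum_adjMatrix_mul_adjMatrix hB)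
  have hq : (1 : ℝ) + y + (e₀ + e₁ * e₂) = 1 + k + e₀ + θ₁ * θ₂ := by rw [hy]; ring
  have hq0 : 0 < 1 + k + e₀ + θ₁ * θ₂ := by
    rw [← hq]
    positivity
  rw [hq, ← adjMatrix_coneGraph_pointBlockGraph H blk x ε hH] at hquad
  have hmul := coneMatrix_mulVec_cellVec (ε := ε) hQ.card_points hQ.card_blocks
    (hQ.sum_inc_points ℝ) (hQ.sum_inc_blocks ℝ) hrow
  rw [← adjMatrix_coneGraph_pointBlockGraph H blk x ε hH] at hmul
  have hsymm : ((coneGraph (pointBlockGraph H blk x)).adjMatrix ℝ).IsSymm :=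
    SimpleGraph.isSymm_adjMatrix _
  set A := (coneGraph (pointBlockGraph H blk x)).adjMatrix ℝ with hA
  set a : ℝ := v + b + θ₁ * θ₂ with ha_def
  set q : ℝ := 1 + k + e₀ + θ₁ * θ₂ with hq_def
  set p : ℝ := 1 + ε * (v - 1) + r + θ₁ * θ₂ with hp_def
  set s : ℝ := ε * (v - 1) + r - θ₁ - θ₂ with hs_def
  set t : ℝ := k + e₀ - θ₁ - θ₂ with ht_def
  set u : ℝ := 1 + ε * k + ((lam : ℝ) * k - y * r) / (x - y) with hu_def
  -- `A` commutes with the cell matrix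
  set C : Matrix (Option (P ⊕ B)) (Option (P ⊕ B)) ℝ := cellMatrix a s t p u q with hC
  have hcomm : A * C = C * A := by
    rw [← hquad]; noncomm_ring
  have hcol : ∀ j, (A * C).col j =
      A.mulVec ((C).col j) := fun j => rfl
  have hrw : ∀ i j, (C * A) i j =
      A.mulVec ((C) i) j := fun i j => by
    rw [Matrix.mul_apply, Matrix.mulVec, dotProduct]
    exact Finset.sum_congr rfl fun l _ => by rw [hsymm.apply l j, mul_comm]
  have hcell : ∀ i j, A.mulVec ((C).col j) i =
      A.mulVec ((C) i) j := fun i j => by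
    rw [← hrw, ← hcol, hcomm]
    rfl
  have hcP : (C).col (some (.inl p₀)) = cellVec (P := P) (B := B) s p u := by
    funext i; rcases i with _ | i | i <;> rfl
  have hrA : (C) none = cellVec (P := P) (B := B) a s t := by
    funext i; rcases i with _ | i | i <;> rfl
  have hrB : (C) (some (.inr j₀)) = cellVec (P := P) (B := B) t u q := by
    funext i; rcases i with _ | i | i <;> rfl
  -- Two entries of AC = CA: v p + b u = a + ε(v − 1)s + r t, and s + k p + e₀u = t + ε(v − 1)u + r
  -- q.
  have hc₁ := hcell none (some (.inl p₀))
  rw [hcP, hrA, hmul, hmul] at hc₁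
  have hc₂ := hcell (some (.inr j₀)) (some (.inl p₀))
  rw [hcP, hrB, hmul, hmul] at hc₂
  simp only [cellVec] at hc₁ hc₂
  have ht0 : 0 ≤ t := h₁ ▸ Real.sqrt_nonneg _
  have hs0 : 0 ≤ s := h₂ ▸ Real.sqrt_nonneg _
  have hu0 : 0 ≤ u := h₃ ▸ Real.sqrt_nonneg _
  -- As `√` is 0 on negative numbers, the hypotheses do not directly exclude p ≤ 0. But then s = u =
  -- 0, the first relation forces p = 0, and the second equates 0 with t + r q > 0.
  have hp0 : 0 < p := by
    by_contra! hp
    have hs : s = 0 := by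
      rw [h₂]; exact Real.sqrt_eq_zero_of_nonpos (mul_nonpos_of_nonneg_of_nonpos ha hp)
    have hu : u = 0 := by
      rw [h₃]; exact Real.sqrt_eq_zero_of_nonpos (mul_nonpos_of_nonpos_of_nonneg hp hq0.le)
    rw [hs, hu] at hc₁ hc₂
    have hvp : 0 ≤ v * p := by
      have := mul_nonneg hr0.le ht0
      linarith
    have hp' : p = 0 := le_antisymm hp (nonneg_of_mul_nonneg_right hvp hv0)
    rw [hp'] at hc₂
    have := mul_pos hr0 hq0
    linarith
  -- If a = 0 then s = t = 0, and the first relation reads v p + b u = 0.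
  have ha0 : 0 < a := by
    refine lt_of_le_of_ne ha fun h => ?_
    rw [← h, zero_mul, Real.sqrt_zero] at h₁ h₂
    rw [h₁, h₂, ← h] at hc₁
    have := mul_pos hv0 hp0
    have := mul_nonneg hb0.le hu0
    linarith
  rw [hC, h₁, h₂, h₃, ← vecMulVec_cellVec_sqrt ha0.le hp0.le hq0.le] at hquad
  have hw : ∀ i, 0 < cellVec (P := P) (B := B) √a √p √q i := by
    rintro (_ | i | i)
    · exact Real.sqrt_pos.2 ha0
    · exact Real.sqrt_pos.2 hp0
    · exact Real.sqrt_pos.2 hq0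
  have : Nonempty (P ⊕ B) := ⟨.inl p₀⟩
  obtain ⟨θ₀, h01, hAw, hspec⟩ := realEigenvalues_eq_of_quadratic_eq_vecMulVec hθ₁ hθ₂ hsymm
    (fun i j => by rw [hA, SimpleGraph.adjMatrix_apply]; split_ifs <;> simp)
    (fun i j => by rw [hA, SimpleGraph.adjMatrix_apply]; split_ifs <;> simp)
    (fun i => by simp [hA]) hw hquad
  have hN : ∀ z : Fin 3 → ℝ, !![0, (v : ℝ), b; 1, ε * (v - 1), r; 1, k, e₀].mulVec z =
      ![v * z 1 + b * z 2, z 0 + ε * (v - 1) * z 1 + r * z 2, z 0 + k * z 1 + e₀ * z 2] := by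
    intro z
    funext i
    fin_cases i <;> simp [Matrix.mulVec, dotProduct, Fin.sum_univ_three]
  refine ⟨θ₀, ⟨?_, ?_⟩, coneGraph_connected _, h01, by linarith, ?_⟩
  · refine mem_realEigenvalues_iff.2 ⟨![√a, √p, √q], fun h => ?_, ?_⟩
    · exact (Real.sqrt_pos.2 ha0).ne' (congrFun h 0)
    · rw [hmul] at hAw
      rw [hN]
      have e0 := congrFun hAw none
      have e1 := congrFun hAw (some (.inl p₀))
      have e2 := congrFun hAw (some (.inr j₀))
      simp only [cellVec, Pi.smul_apply, smul_eq_mul] at e0 e1 e2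
      funext i
      fin_cases i
      · simpa using e0
      · simpa using e1
      · simpa using e2
  -- Eigenvectors of the quotient lift to eigenvectors of A constant on cells.
  · intro μ hμ
    obtain ⟨z, hz0, hz⟩ := mem_realEigenvalues_iff.1 hμ
    rw [hN] at hz
    have hmem : μ ∈ realEigenvalues A := by
      refine mem_realEigenvalues_iff.2 ⟨cellVec (z 0) (z 1) (z 2), fun h => hz0 ?_, ?_⟩
      · funext i
        fin_cases i
        · exact congrFun h none
        · exact congrFun h (some (.inl p₀))
        · exact congrFun h (some (.inr j₀))
      · rw [hmul]
        funext i
        rcases i with _ | i | i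
        · simpa [cellVec] using congrFun hz 0
        · simpa [cellVec] using congrFun hz 1
        · simpa [cellVec] using congrFun hz 2
    rw [hspec] at hmem
    rcases hmem with h | h | h
    · exact h.le
    · rw [h]; exact h01.le
    · rw [Set.mem_singleton_iff.1 h]; linarith
  · rw [← hspec, hA]

end IsQSD

/-! ### The fourteen classes and closure under products -/

section Colours

variable {P B : Type*} [DecidableEq P] [DecidableEq B]

/-- The fourteen classes of pairs of vertices of the cone over the points and blocks of a
quasi-symmetric design. -/
def coneColour (blk : B → Finset P) (x : ℕ) : Option (P ⊕ B) → Option (P ⊕ B) → Fin 14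
  | none, none => 0
  | none, some (.inl _) => 1
  | none, some (.inr _) => 2
  | some (.inl _), none => 3
  | some (.inr _), none => 4
  | some (.inl p), some (.inl q) => if p = q then 5 else 6
  | some (.inl p), some (.inr j) => if p ∈ blk j then 7 else 8
  | some (.inr j), some (.inl p) => if p ∈ blk j then 9 else 10
  | some (.inr i), some (.inr j) => if i = j then 11 else if (blk i ∩ blk j).card = x then 12 else 13

theorem coneColour_swap (blk : B → Finset P) (x : ℕ) (i j : Option (P ⊕ B)) :
    coneColour blk x j i =
      ![0, 3, 4, 1, 2, 5, 6, 9, 10, 7, 8, 11, 12, 13] (coneColour blk x i j) := by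
  rcases i with _ | p | i <;> rcases j with _ | q | j <;> simp only [coneColour]
  · rfl
  · rfl
  · rfl
  · rfl
  · simp only [eq_comm (a := q)]; split_ifs <;> rfl
  · split_ifs <;> rfl
  · rfl
  · split_ifs <;> rfl
  · simp only [eq_comm (a := j), Finset.inter_comm (blk j)]; split_ifs <;> rfl

/-- The zero term only supplies the shape that `sum_three_mul_three` matches. -/
theorem apply_coneColour_points (blk : B → Finset P) (x : ℕ)
    (f : Fin 14 → ℂ) (p q : P) :
    f (coneColour blk x (some (.inl p)) (some (.inl q))) =
      f 6 + (f 5 - f 6) * (1 : Matrix P P ℂ) p q + 0 * (1 : Matrix P P ℂ) p q := by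
  simp only [coneColour, Matrix.one_apply]
  split_ifs <;> ring

theorem apply_coneColour_point_block (blk : B → Finset P) (x : ℕ)
    (f : Fin 14 → ℂ) (p : P) (j : B) :
    f (coneColour blk x (some (.inl p)) (some (.inr j))) =
      f 8 + (f 7 - f 8) * incMatrix ℂ blk p j + 0 * incMatrix ℂ blk p j := by
  simp only [coneColour, incMatrix, Matrix.of_apply]
  split_ifs <;> ring

theorem apply_coneColour_block_point (blk : B → Finset P) (x : ℕ)
    (f : Fin 14 → ℂ) (p : P) (j : B) :
    f (coneColour blk x (some (.inr j)) (some (.inl p))) =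
      f 10 + (f 9 - f 10) * incMatrix ℂ blk p j + 0 * incMatrix ℂ blk p j := by
  simp only [coneColour, incMatrix, Matrix.of_apply]
  split_ifs <;> ring

end Colours

namespace IsQSD

variable {P B : Type*} [Fintype P] [DecidableEq P] [Fintype B] [DecidableEq B]
  {blk : B → Finset P} {v k lam b r x y : ℕ}

theorem coneColour_surjective (hQ : IsQSD blk v k lam b r x y) (c : Fin 14) :
    ∃ i j, coneColour blk x i j = c := by
  obtain ⟨p, q, hpq⟩ := hQ.exists_points_ne
  obtain ⟨i, j, hij, hx⟩ := hQ.x_occurs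
  obtain ⟨i', j', hij', hy⟩ := hQ.y_occurs
  obtain ⟨p₁, hp₁⟩ := hQ.exists_mem i
  obtain ⟨p₂, hp₂⟩ := hQ.exists_notMem i
  have hyx := hQ.x_ne_y.symm
  fin_cases c
  · exact ⟨none, none, rfl⟩
  · exact ⟨none, some (.inl p), rfl⟩
  · exact ⟨none, some (.inr i), rfl⟩
  · exact ⟨some (.inl p), none, rfl⟩
  · exact ⟨some (.inr i), none, rfl⟩
  · exact ⟨some (.inl p), some (.inl p), by simp [coneColour]⟩
  · exact ⟨some (.inl p), some (.inl q), by simp [coneColour, hpq]⟩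
  · exact ⟨some (.inl p₁), some (.inr i), by simp [coneColour, hp₁]⟩
  · exact ⟨some (.inl p₂), some (.inr i), by simp [coneColour, hp₂]⟩
  · exact ⟨some (.inr i), some (.inl p₁), by simp [coneColour, hp₁]⟩
  · exact ⟨some (.inr i), some (.inl p₂), by simp [coneColour, hp₂]⟩
  · exact ⟨some (.inr i), some (.inr i), by simp [coneColour]⟩
  · exact ⟨some (.inr i), some (.inr j), by simp [coneColour, hij, hx]⟩
  · exact ⟨some (.inr i'), some (.inr j'), by simp [coneColour, hij', hy, hyx]⟩

/-- A linear function of the intersection number, of slope (f 12 − f 13)/(x − y), interpolates the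
two off-diagonal colours; the multiple of I repairs the diagonal, where that number is k. -/
theorem exists_apply_coneColour_blocks (hQ : IsQSD blk v k lam b r x y) (f : Fin 14 → ℂ) :
    ∃ c d e : ℂ, ∀ i j, f (coneColour blk x (some (.inr i)) (some (.inr j))) =
      c + d * (1 : Matrix B B ℂ) i j + e * gramMatrix ℂ blk i j := by
  have hne := hQ.cast_x_sub_y_ne_zero ℂ
  refine ⟨f 13 - (f 12 - f 13) / (x - y) * y,
    f 11 - f 13 + (f 12 - f 13) / (x - y) * y - (f 12 - f 13) / (x - y) * k,
    (f 12 - f 13) / (x - y), fun i j => ?_⟩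
  rcases eq_or_ne i j with rfl | hij
  · simp only [coneColour, gramMatrix, Matrix.of_apply, Matrix.one_apply_eq, if_true,
      Finset.inter_self, hQ.block_card]
    ring
  · rcases hQ.inter_card i j hij with h | h
    · simp only [coneColour, gramMatrix, Matrix.of_apply, Matrix.one_apply_ne hij, hij, if_false, h,
        if_true]
      field_simp
      ring
    · simp only [coneColour, gramMatrix, Matrix.of_apply, Matrix.one_apply_ne hij, hij, if_false, h,
        hQ.x_ne_y.symm]
      ring

theorem gram_eq_of_coneColour_eq (hQ : IsQSD blk v k lam b r x y) {i j i' j' : B}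
    (h : coneColour blk x (some (.inr i')) (some (.inr j')) =
      coneColour blk x (some (.inr i)) (some (.inr j))) :
    (1 : Matrix B B ℂ) i j = (1 : Matrix B B ℂ) i' j' ∧
      gramMatrix ℂ blk i j = gramMatrix ℂ blk i' j' := by
  have hy : ∀ i j, i ≠ j → (blk i ∩ blk j).card ≠ x → (blk i ∩ blk j).card = y :=
    fun i j hij hn => (hQ.inter_card i j hij).resolve_left hn
  simp only [coneColour] at h
  simp only [Matrix.one_apply, gramMatrix, Matrix.of_apply]
  split_ifs at h ⊢ <;> first | exact absurd h (by decide) | skip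
  all_goals simp_all [hQ.block_card]
  rw [hy i j ‹_› ‹_›, hy i' j' ‹_› ‹_›]

/-- A matrix is constant on colour classes as soon as each of its nine blocks is. -/
theorem exists_eq_coneColour (hQ : IsQSD blk v k lam b r x y)
    {Z : Matrix (Option (P ⊕ B)) (Option (P ⊕ B)) ℂ}
    (hAP : ∀ p q, Z none (some (.inl p)) = Z none (some (.inl q)))
    (hAB : ∀ i j, Z none (some (.inr i)) = Z none (some (.inr j)))
    (hPA : ∀ p q, Z (some (.inl p)) none = Z (some (.inl q)) none)
    (hBA : ∀ i j, Z (some (.inr i)) none = Z (some (.inr j)) none)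
    (hPP : ∀ p q p' q', (1 : Matrix P P ℂ) p q = (1 : Matrix P P ℂ) p' q' →
      Z (some (.inl p)) (some (.inl q)) = Z (some (.inl p')) (some (.inl q')))
    (hPB : ∀ p j p' j', incMatrix ℂ blk p j = incMatrix ℂ blk p' j' →
      Z (some (.inl p)) (some (.inr j)) = Z (some (.inl p')) (some (.inr j')))
    (hBP : ∀ p j p' j', incMatrix ℂ blk p j = incMatrix ℂ blk p' j' →
      Z (some (.inr j)) (some (.inl p)) = Z (some (.inr j')) (some (.inl p')))
    (hBB : ∀ i j i' j', (1 : Matrix B B ℂ) i j = (1 : Matrix B B ℂ) i' j' →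
      gramMatrix ℂ blk i j = gramMatrix ℂ blk i' j' →
      Z (some (.inr i)) (some (.inr j)) = Z (some (.inr i')) (some (.inr j'))) :
    ∃ f : Fin 14 → ℂ, ∀ i j, Z i j = f (coneColour blk x i j) := by
  -- Every colour occurs, so f can be read off at one representative pair per colour.
  choose rep₁ rep₂ hrep using hQ.coneColour_surjective
  refine ⟨fun c => Z (rep₁ c) (rep₂ c), fun i j => ?_⟩
  have h := hrep (coneColour blk x i j)
  beta_reduce
  generalize rep₁ (coneColour blk x i j) = i', rep₂ (coneColour blk x i j) = j' at h
  rcases i with _ | p | i <;> rcases j with _ | q | j <;> rcases i' with _ | p' | i' <;>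
    rcases j' with _ | q' | j' <;>
    first
    | rfl
    | exact hAP _ _
    | exact hAB _ _
    | exact hPA _ _
    | exact hBA _ _
    | exact hBB _ _ _ _ (hQ.gram_eq_of_coneColour_eq h).1 (hQ.gram_eq_of_coneColour_eq h).2
    | (simp only [coneColour] at h; exact absurd h (by decide))
    | skip
  all_goals
    simp only [coneColour] at h
    split_ifs at h <;>
    first
    | exact absurd h (by decide)
    | (apply hPP; simp [Matrix.one_apply, *])
    | (apply hPB; simp [incMatrix, *])
    | (apply hBP; simp [incMatrix, *])

theorem mul_eq_coneColour (hQ : IsQSD blk v k lam b r x y)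
    {Z W : Matrix (Option (P ⊕ B)) (Option (P ⊕ B)) ℂ}
    (hZ : ∃ f : Fin 14 → ℂ, ∀ i j, Z i j = f (coneColour blk x i j))
    (hW : ∃ f : Fin 14 → ℂ, ∀ i j, W i j = f (coneColour blk x i j)) :
    ∃ f : Fin 14 → ℂ, ∀ i j, (Z * W) i j = f (coneColour blk x i j) := by
  obtain ⟨f, hf⟩ := hZ
  obtain ⟨g, hg⟩ := hW
  obtain ⟨c, d, e, hfB⟩ := hQ.exists_apply_coneColour_blocks f
  obtain ⟨c', d', e', hgB⟩ := hQ.exists_apply_coneColour_blocks g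
  have hmul : ∀ i j, (Z * W) i j = Z i none * W none j +
      (∑ p, Z i (some (.inl p)) * W (some (.inl p)) j +
        ∑ l, Z i (some (.inr l)) * W (some (.inr l)) j) := fun i j => by
    rw [Matrix.mul_apply, Fintype.sum_option, Fintype.sum_sum_type]
  have oneP : ∀ (p : P) (F : P → ℂ), ∑ q, (1 : Matrix P P ℂ) p q * F q = F p := fun p F => by
    simp [Matrix.one_apply]
  have oneP' : ∀ (p : P) (F : P → ℂ), ∑ q, F q * (1 : Matrix P P ℂ) q p = F p := fun p F => by
    simp [Matrix.one_apply]
  have oneB : ∀ (i : B) (F : B → ℂ), ∑ j, (1 : Matrix B B ℂ) i j * F j = F i := fun i F => by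
    simp [Matrix.one_apply]
  have oneB' : ∀ (i : B) (F : B → ℂ), ∑ j, F j * (1 : Matrix B B ℂ) j i = F i := fun i F => by
    simp [Matrix.one_apply]
  have sP : ∀ p : P, ∑ q, (1 : Matrix P P ℂ) p q = 1 := fun p => by simp [Matrix.one_apply]
  have sP' : ∀ p : P, ∑ q, (1 : Matrix P P ℂ) q p = 1 := fun p => by simp [Matrix.one_apply]
  have sB : ∀ i : B, ∑ j, (1 : Matrix B B ℂ) i j = 1 := fun i => by simp [Matrix.one_apply]
  have sB' : ∀ i : B, ∑ j, (1 : Matrix B B ℂ) j i = 1 := fun i => by simp [Matrix.one_apply]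
  have sG' : ∀ i : B, ∑ j, gramMatrix ℂ blk j i = k * r := fun i => by
    simp_rw [gramMatrix_comm ℂ blk _ i]
    exact hQ.sum_gram ℂ i
  have sGM : ∀ (p : P) (i : B), ∑ j, gramMatrix ℂ blk i j * incMatrix ℂ blk p j =
      lam * k + (r - lam) * incMatrix ℂ blk p i := fun p i => by
    rw [← hQ.sum_inc_mul_gram ℂ]
    exact Finset.sum_congr rfl fun j _ => by rw [gramMatrix_comm, mul_comm]
  -- Each entry of the product reduces to constants and entries of I, M or the Gram matrix at the
  -- same pair.
  apply hQ.exists_eq_coneColour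
  all_goals
    intros
    simp only [hmul, hf, hg, apply_coneColour_points, apply_coneColour_point_block,
      apply_coneColour_block_point, hfB, hgB, sum_three_mul_three]
    simp only [coneColour, ← Finset.mul_sum, ← Finset.sum_mul, Finset.sum_add_distrib, oneP, oneP',
      oneB, oneB', sP, sP', sB, sB', sG', sGM, hQ.sum_inc_points ℂ, hQ.sum_inc_blocks ℂ,
      hQ.sum_inc_mul_inc_blocks ℂ, sum_inc_mul_inc_points, hQ.sum_gram ℂ, hQ.sum_inc_mul_gram ℂ,
      hQ.sum_gram_mul_gram ℂ]
    try simp only [*]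

end IsQSD

/-! ### The coherent closure and its rank -/

/-- A diagonal matrix with distinct values on the three cells generates all diagonal matrices that
are constant on cells. -/
theorem diagonal_cellVec_mem {P B : Type*} [Fintype P] [DecidableEq P] [Fintype B] [DecidableEq B]
    {S : Subalgebra ℂ (Matrix (Option (P ⊕ B)) (Option (P ⊕ B)) ℂ)} {α β γ : ℂ}
    (h : Matrix.diagonal (cellVec α β γ) ∈ S) (hαβ : α ≠ β) (hαγ : α ≠ γ) (hβγ : β ≠ γ)
    (a p q : ℂ) : Matrix.diagonal (cellVec a p q) ∈ S := by
  have hs : ∀ z : ℂ, Matrix.diagonal (fun i => cellVec (P := P) (B := B) α β γ i - z) ∈ S := by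
    intro z
    have := S.sub_mem h (S.smul_mem S.one_mem z)
    rwa [← Matrix.diagonal_one, ← Matrix.diagonal_smul, Matrix.diagonal_sub,
      show (fun i => cellVec (P := P) (B := B) α β γ i - (z • fun _ => (1 : ℂ)) i) =
        fun i => cellVec (P := P) (B := B) α β γ i - z by ext; simp] at this
  have hp := fun z z' => S.mul_mem (hs z) (hs z')
  simp only [Matrix.diagonal_mul_diagonal] at hp
  -- Lagrange interpolation at the nodes α, β, γ.
  have := S.add_mem (S.add_mem (S.smul_mem (hp β γ) (a / ((α - β) * (α - γ))))
    (S.smul_mem (hp α γ) (p / ((β - α) * (β - γ)))))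
    (S.smul_mem (hp α β) (q / ((γ - α) * (γ - β))))
  simp only [← Matrix.diagonal_smul, Matrix.diagonal_add] at this
  refine (congrArg (fun d => Matrix.diagonal d ∈ S) (?_ : _ = cellVec a p q)).mp this
  have h₁ := sub_ne_zero.2 hαβ
  have h₂ := sub_ne_zero.2 hαγ
  have h₃ := sub_ne_zero.2 hβγ
  have h₁' := sub_ne_zero.2 hαβ.symm
  have h₂' := sub_ne_zero.2 hαγ.symm
  have h₃' := sub_ne_zero.2 hβγ.symm
  funext i
  rcases i with _ | i | i <;> simp [cellVec] <;> field_simp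

theorem ne_of_ncard_eq_three {α : Type*} {a b c : α} (h : ({a, b, c} : Set α).ncard = 3) :
    a ≠ b ∧ a ≠ c ∧ b ≠ c := by
  have hp : ∀ s t : α, ({s, t} : Set α).ncard ≤ 2 := fun s t =>
    (Set.ncard_insert_le s {t}).trans (by rw [Set.ncard_singleton])
  refine ⟨?_, ?_, ?_⟩ <;> rintro rfl
  · have := hp a c
    simp at h
    omega
  · have := hp a b
    rw [Set.insert_comm, Set.pair_eq_singleton, Set.pair_comm] at h
    omega
  · have := hp a b
    rw [Set.pair_eq_singleton] at h
    omega

theorem adjMatrix_coneGraph_eq_coneColour {P B : Type*} [DecidableEq P] [DecidableEq B]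
    (H : SimpleGraph P) (E : Prop) [Decidable E]
    (hH : ∀ p q, H.Adj p q ↔ E ∧ p ≠ q) (blk : B → Finset P) (x : ℕ)
    [DecidableRel (coneGraph (pointBlockGraph H blk x)).Adj] (i j : Option (P ⊕ B)) :
    (coneGraph (pointBlockGraph H blk x)).adjMatrix ℂ i j =
      ![0, 1, 1, 1, 1, 0, if E then 1 else 0, 1, 0, 1, 0, 0, 1, 0] (coneColour blk x i j) := by
  classical
  rw [SimpleGraph.adjMatrix_apply]
  rcases i with _ | p | i <;> rcases j with _ | q | j
  · exact if_neg id
  · exact if_pos trivial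
  · exact if_pos trivial
  · exact if_pos trivial
  · rw [if_congr (Iff.trans (show (coneGraph (pointBlockGraph H blk x)).Adj (some (.inl p)) (some (.inl q)) ↔
      H.Adj p q from Iff.rfl) (hH p q)) rfl rfl]
    by_cases h : p = q <;> simp [coneColour, h]
  · rw [if_congr (show (coneGraph (pointBlockGraph H blk x)).Adj (some (.inl p)) (some (.inr j)) ↔
      p ∈ blk j from Iff.rfl) rfl rfl]
    by_cases h : p ∈ blk j <;> simp [coneColour, h]
  · exact if_pos trivial
  · rw [if_congr (show (coneGraph (pointBlockGraph H blk x)).Adj (some (.inr i)) (some (.inl q)) ↔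
      q ∈ blk i from Iff.rfl) rfl rfl]
    by_cases h : q ∈ blk i <;> simp [coneColour, h]
  · rw [if_congr (show (coneGraph (pointBlockGraph H blk x)).Adj (some (.inr i)) (some (.inr j)) ↔
      i ≠ j ∧ (blk i ∩ blk j).card = x from Iff.rfl) rfl rfl]
    by_cases h : i = j
    · simp [coneColour, h]
    · by_cases h' : (blk i ∩ blk j).card = x <;> simp [coneColour, h, h']

namespace IsQSD

variable {P B : Type*} [Fintype P] [DecidableEq P] [Fintype B] [DecidableEq B]
  {blk : B → Finset P} {v k lam b r x y : ℕ}

/-- The coherent algebra of matrices that are constant on the fourteen colour classes. -/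
def coneAlgebra (hQ : IsQSD blk v k lam b r x y) :
    Subalgebra ℂ (Matrix (Option (P ⊕ B)) (Option (P ⊕ B)) ℂ) where
  carrier := {Z | ∃ f : Fin 14 → ℂ, ∀ i j, Z i j = f (coneColour blk x i j)}
  mul_mem' := hQ.mul_eq_coneColour
  add_mem' := by
    rintro Z W ⟨f, hf⟩ ⟨g, hg⟩
    exact ⟨f + g, fun i j => by simp [hf, hg]⟩
  algebraMap_mem' c := by
    refine ⟨![c, 0, 0, 0, 0, c, 0, 0, 0, 0, 0, c, 0, 0], fun i j => ?_⟩
    rw [Matrix.algebraMap_matrix_apply]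
    rcases i with _ | p | i <;> rcases j with _ | q | j <;> simp [coneColour] <;>
      split_ifs <;> rfl

theorem isCoherentAlgebra_coneAlgebra (hQ : IsQSD blk v k lam b r x y) :
    IsCoherentAlgebra hQ.coneAlgebra where
  allOnes_mem := ⟨1, fun _ _ => rfl⟩
  transpose_mem := by
    rintro Z ⟨f, hf⟩
    exact ⟨fun c => f (![0, 3, 4, 1, 2, 5, 6, 9, 10, 7, 8, 11, 12, 13] c),
      fun i j => by rw [Matrix.transpose_apply, hf, coneColour_swap]⟩
  hadamard_mem := by
    rintro Z ⟨f, hf⟩ W ⟨g, hg⟩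
    exact ⟨f * g, fun i j => by rw [Matrix.hadamard_apply, hf, hg]; rfl⟩

theorem finrank_coneAlgebra (hQ : IsQSD blk v k lam b r x y) :
    Module.finrank ℂ hQ.coneAlgebra = 14 := by
  let Φ : (Fin 14 → ℂ) →ₗ[ℂ] Matrix (Option (P ⊕ B)) (Option (P ⊕ B)) ℂ :=
    { toFun := fun f => Matrix.of fun i j => f (coneColour blk x i j)
      map_add' := fun _ _ => rfl
      map_smul' := fun _ _ => rfl }
  have hΦ : Function.Injective Φ := by
    intro f g h
    funext c
    obtain ⟨i, j, rfl⟩ := hQ.coneColour_surjective c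
    exact congrFun (congrFun h i) j
  have hr : Subalgebra.toSubmodule hQ.coneAlgebra = LinearMap.range Φ := by
    ext Z
    constructor
    · rintro ⟨f, hf⟩
      exact ⟨f, by ext i j; exact (hf i j).symm⟩
    · rintro ⟨f, rfl⟩
      exact ⟨f, fun _ _ => rfl⟩
  rw [← Subalgebra.finrank_toSubmodule, hr, LinearMap.finrank_range_of_inj hΦ, Module.finrank_fin_fun]

open Classical in
theorem coneAlgebra_le (hQ : IsQSD blk v k lam b r x y) (H : SimpleGraph P) (E : Prop)
    (hH : ∀ p q, H.Adj p q ↔ E ∧ p ≠ q) {dA dP dB : ℝ}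
    (hdeg : ∀ i, ((coneGraph (pointBlockGraph H blk x)).degree i : ℝ) = cellVec dA dP dB i)
    (hAP : dA ≠ dP) (hAB : dA ≠ dB) (hPB : dP ≠ dB)
    {S : Subalgebra ℂ (Matrix (Option (P ⊕ B)) (Option (P ⊕ B)) ℂ)} (hS : IsCoherentAlgebra S)
    (hA : (coneGraph (pointBlockGraph H blk x)).adjMatrix ℂ ∈ S) : hQ.coneAlgebra ≤ S := by
  have hentry := adjMatrix_coneGraph_eq_coneColour H E hH blk x
  have hD : Matrix.diagonal (cellVec (P := P) (B := B) (dA : ℂ) dP dB) ∈ S := by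
    -- The entrywise product of A² with I is the diagonal matrix of degrees.
    have h := hS.hadamard_mem _ (S.mul_mem hA hA) _ S.one_mem
    convert h using 1
    ext i j
    rw [Matrix.hadamard_apply]
    rcases eq_or_ne i j with rfl | hij
    · have := hdeg i
      rw [Matrix.diagonal_apply_eq, Matrix.one_apply_eq, mul_one,
        SimpleGraph.adjMatrix_mul_self_apply_self]
      rw [← Complex.ofReal_natCast, this]
      rcases i with _ | i | i <;> rfl
    · rw [Matrix.diagonal_apply_ne _ hij, Matrix.one_apply_ne hij, mul_zero]
  have hdiag := diagonal_cellVec_mem hD (Complex.ofReal_injective.ne hAP)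
    (Complex.ofReal_injective.ne hAB) (Complex.ofReal_injective.ne hPB)
  generalize (coneGraph (pointBlockGraph H blk x)).adjMatrix ℂ = A at hA hentry
  have hJ := hS.allOnes_mem
  generalize hJ' : (Matrix.of fun _ _ => (1 : ℂ) :
    Matrix (Option (P ⊕ B)) (Option (P ⊕ B)) ℂ) = J at hJ
  have hJe : ∀ i j, J i j = 1 := fun i j => by rw [← hJ']; rfl
  set eA := Matrix.diagonal (cellVec (P := P) (B := B) (1 : ℂ) 0 0) with heA
  set eP := Matrix.diagonal (cellVec (P := P) (B := B) (0 : ℂ) 1 0) with heP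
  set eB := Matrix.diagonal (cellVec (P := P) (B := B) (0 : ℂ) 0 1) with heB
  have hmA : eA ∈ S := hdiag 1 0 0
  have hmP : eP ∈ S := hdiag 0 1 0
  have hmB : eB ∈ S := hdiag 0 0 1
  have hmul : ∀ {X Y Z}, X ∈ S → Y ∈ S → Z ∈ S → X * Y * Z ∈ S := fun hX hY hZ =>
    S.mul_mem (S.mul_mem hX hY) hZ
  rintro Z ⟨f, hf⟩
  -- On points I and J suffice, so A is cut only at incidences and block pairs, and the choice of
  -- `E` plays no role.
  have hZ : Z = f 0 • (eA * J * eA) + f 1 • (eA * J * eP) + f 2 • (eA * J * eB)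
      + f 3 • (eP * J * eA) + f 4 • (eB * J * eA) + f 6 • (eP * J * eP) + (f 5 - f 6) • eP
      + f 8 • (eP * J * eB) + (f 7 - f 8) • (eP * A * eB)
      + f 10 • (eB * J * eP) + (f 9 - f 10) • (eB * A * eP)
      + f 13 • (eB * J * eB) + (f 12 - f 13) • (eB * A * eB) + (f 11 - f 13) • eB := by
    ext i j
    simp only [hf, Matrix.add_apply, Matrix.smul_apply, heA, heP, heB, Matrix.diagonal_mul,
      Matrix.mul_diagonal, hJe, hentry, smul_eq_mul, Matrix.diagonal_apply]
    rcases i with _ | p | i <;> rcases j with _ | q | j <;> simp [coneColour, cellVec] <;>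
      split_ifs <;> simp
  rw [hZ]
  iterate 13 refine S.add_mem ?_ ?_
  all_goals
    refine S.smul_mem ?_ _
    first
    | assumption
    | exact hmul ‹_› ‹_› ‹_›

/-- The coherent rank of the cone when the three cells have distinct degrees. -/
theorem coherentRank_coneGraph (hQ : IsQSD blk v k lam b r x y) (H : SimpleGraph P) (E : Prop)
    (hH : ∀ p q, H.Adj p q ↔ E ∧ p ≠ q)
    [∀ i, Fintype ((coneGraph (pointBlockGraph H blk x)).neighborSet i)] {dA dP dB : ℝ}
    (hdeg : ∀ i, ((coneGraph (pointBlockGraph H blk x)).degree i : ℝ) = cellVec dA dP dB i)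
    (hAP : dA ≠ dP) (hAB : dA ≠ dB) (hPB : dP ≠ dB) :
    coherentRank (coneGraph (pointBlockGraph H blk x)) = 14 := by
  classical
  have h : coherentClosure (coneGraph (pointBlockGraph H blk x)) = hQ.coneAlgebra := by
    refine le_antisymm (sInf_le ⟨hQ.isCoherentAlgebra_coneAlgebra, _,
      adjMatrix_coneGraph_eq_coneColour H E hH blk x⟩) (le_sInf ?_)
    rintro S ⟨hS, hA⟩
    exact hQ.coneAlgebra_le H E hH (fun i => by rw [← hdeg]; congr!) hAP hAB hPB hS hA
  rw [coherentRank, h, hQ.finrank_coneAlgebra]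

theorem degree_coneGraph (hQ : IsQSD blk v k lam b r x y) {e₀ e₁ e₂ ε : ℝ}
    (hB : InG3 (blockGraph blk x) e₀ e₁ e₂) (H : SimpleGraph P) [DecidableRel H.Adj]
    (hH : ∀ p q, H.adjMatrix ℝ p q = ε * (1 - (1 : Matrix P P ℝ) p q))
    [∀ i, Fintype ((coneGraph (pointBlockGraph H blk x)).neighborSet i)] (i : Option (P ⊕ B)) :
    ((coneGraph (pointBlockGraph H blk x)).degree i : ℝ) =
      cellVec (v + b : ℝ) (1 + ε * (v - 1) + r) (1 + k + e₀) i := by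
  classical
  have hmul := coneMatrix_mulVec_cellVec (ε := ε) hQ.card_points hQ.card_blocks
    (hQ.sum_inc_points ℝ) (hQ.sum_inc_blocks ℝ)
    (X := (blockGraph blk x).adjMatrix ℝ) (d := e₀)
    (fun i => by rw [hQ.sum_blockGraph_adjMatrix i, (hQ.blockGraph_spectrum hB).1]) 1 1 1
  rw [← adjMatrix_coneGraph_pointBlockGraph H blk x ε hH,
    show cellVec (P := P) (B := B) (1 : ℝ) 1 1 = Function.const _ 1 by
      funext i; rcases i with _ | i | i <;> rfl] at hmul
  have := congrFun hmul i
  rw [SimpleGraph.adjMatrix_mulVec_const_apply] at this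
  simp only [mul_one] at this
  rw [← this]
  congr!

end IsQSD

theorem IsQSD.isTriregular_coneGraph {P B : Type*} [Fintype P] [DecidableEq P] [Fintype B]
    {blk : B → Finset P} {v k lam b r x y : ℕ} (hQ : IsQSD blk v k lam b r x y) (H : SimpleGraph P)
    [∀ i, Fintype ((coneGraph (pointBlockGraph H blk x)).neighborSet i)] {dA dP dB : ℝ}
    (hdeg : ∀ i, ((coneGraph (pointBlockGraph H blk x)).degree i : ℝ) = cellVec dA dP dB i)
    (h : ({dA, dP, dB} : Set ℝ).ncard = 3) :
    IsTriregular (coneGraph (pointBlockGraph H blk x)) := by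
  obtain ⟨p, -⟩ := hQ.exists_points_ne
  obtain ⟨j, -⟩ := hQ.x_occurs
  rw [IsTriregular, ← Set.ncard_image_of_injective _ (Nat.cast_injective (R := ℝ)), ← h]
  congr 1
  ext z
  constructor
  · rintro ⟨_, ⟨i, rfl⟩, rfl⟩
    have := hdeg i
    rcases i with _ | i | i
    · left; rw [← show _ = dA from this]; congr!
    · right; left; rw [← show _ = dP from this]; congr!
    · right; right; rw [Set.mem_singleton_iff, ← show _ = dB from this]; congr!
  · rintro (rfl | rfl | rfl)
    · refine ⟨_, ⟨none, rfl⟩, (Eq.trans ?_ (hdeg none))⟩; congr!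
    · refine ⟨_, ⟨some (.inl p), rfl⟩, (Eq.trans ?_ (hdeg (some (.inl p))))⟩; congr!
    · refine ⟨_, ⟨some (.inr j), rfl⟩, (Eq.trans ?_ (hdeg (some (.inr j))))⟩; congr!

/-! ### Specialising to the total and whole graphs -/

theorem theorem6p5 {P B : Type*} [Fintype P] [DecidableEq P] [Fintype B] [DecidableEq B]
    (blk : B → Finset P) (v k lam b r x y : ℕ) (hQ : IsQSD blk v k lam b r x y)
    (θ₁ θ₂ : ℤ) (hθ₁ : 1 ≤ θ₁) (hθ₂ : θ₂ ≤ -2)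
    (e₀ e₁ e₂ : ℝ) (hB : InG3 (blockGraph blk x) e₀ e₁ e₂)
    (hx : (x : ℝ) = k + (θ₁ + 1) * (θ₂ + 1) - (e₁ + 1) * (e₂ + 1))
    (hy : (y : ℝ) = k + θ₁ * θ₂ - e₁ * e₂) :
    ((lam : ℝ) = r + θ₁ * θ₂ →
      ((r : ℝ) - lam + y - k) / (x - y) = θ₁ + θ₂ →
      k + e₀ - θ₁ - θ₂ = √((v + b + θ₁ * θ₂) * (1 + k + e₀ + θ₁ * θ₂)) →
      (r : ℝ) - θ₁ - θ₂ = √((v + b + θ₁ * θ₂) * (1 + lam)) →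
      1 + ((lam : ℝ) * k - y * r) / (x - y) = √((1 + lam) * (1 + k + e₀ + θ₁ * θ₂)) →
      (∃ θ₀ : ℝ, IsGreatest (realEigenvalues !![0, (v : ℝ), b; 1, 0, r; 1, k, e₀]) θ₀ ∧
        InG3 (coneGraph (totalGraph blk x)) θ₀ θ₁ θ₂) ∧
      (({(v : ℝ) + b, 1 + (r : ℝ), 1 + k + e₀} : Set ℝ).ncard = 3 →
        IsTriregular (coneGraph (totalGraph blk x)) ∧
        coherentRank (coneGraph (totalGraph blk x)) = 14)) ∧
    ((lam : ℝ) = r + (θ₁ + 1) * (θ₂ + 1) →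
      ((r : ℝ) - lam + y - k) / (x - y) = θ₁ + θ₂ + 1 →
      k + e₀ - θ₁ - θ₂ = √((v + b + θ₁ * θ₂) * (1 + k + e₀ + θ₁ * θ₂)) →
      (v : ℝ) - 1 + r - θ₁ - θ₂ = √((v + b + θ₁ * θ₂) * (v + r + θ₁ * θ₂)) →
      1 + k + ((lam : ℝ) * k - y * r) / (x - y) =
        √((v + r + θ₁ * θ₂) * (1 + k + e₀ + θ₁ * θ₂)) →
      (∃ θ₀ : ℝ, IsGreatest (realEigenvalues !![0, (v : ℝ), b; 1, (v : ℝ) - 1, r; 1, k, e₀]) θ₀ ∧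
        InG3 (coneGraph (wholeGraph blk x)) θ₀ θ₁ θ₂) ∧
      (({(v : ℝ) + b, (v : ℝ) + r, 1 + k + e₀} : Set ℝ).ncard = 3 →
        IsTriregular (coneGraph (wholeGraph blk x)) ∧
        coherentRank (coneGraph (wholeGraph blk x)) = 14)) := by
  classical
  have hθ₁' : (0 : ℝ) < θ₁ := by exact_mod_cast (by linarith : (0 : ℤ) < θ₁)
  have hθ₂' : (θ₂ : ℝ) < -1 := by exact_mod_cast (by linarith : θ₂ < (-1 : ℤ))
  have hv : (1 : ℝ) ≤ v := Nat.one_le_cast.2 (by have := hQ.k_lt_v; omega)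
  have hrb : (r : ℝ) ≤ b := Nat.cast_le.2 hQ.r_le_b
  have hl0 : (0 : ℝ) ≤ lam := Nat.cast_nonneg _
  constructor
  · intro hlam hα h₁ h₂ h₃
    have hH : ∀ p q, (⊥ : SimpleGraph P).adjMatrix ℝ p q =
        (0 : ℝ) * (1 - (1 : Matrix P P ℝ) p q) := fun p q => by simp
    have hp : (1 : ℝ) + lam = 1 + 0 * (v - 1) + r + θ₁ * θ₂ := by rw [hlam]; ring
    rw [hp] at h₂ h₃
    constructor
    · have := hQ.inG3_coneGraph hB hθ₁' hθ₂' (Or.inl rfl) ⊥ hH hx hy (by linarith) (by linarith)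
        (by linarith) h₁ (by rw [← h₂]; ring) (by rw [← h₃]; ring)
      simpa [totalGraph] using this
    · intro hcard
      have hdeg := hQ.degree_coneGraph hB ⊥ hH
      simp only [zero_mul, add_zero] at hdeg
      obtain ⟨hAP, hAB, hPB⟩ := ne_of_ncard_eq_three hcard
      exact ⟨hQ.isTriregular_coneGraph ⊥ hdeg hcard,
        hQ.coherentRank_coneGraph ⊥ False (by simp) hdeg hAP hAB hPB⟩
  · intro hlam hα h₁ h₂ h₃
    have hH : ∀ p q, (⊤ : SimpleGraph P).adjMatrix ℝ p q =
        (1 : ℝ) * (1 - (1 : Matrix P P ℝ) p q) := fun p q => by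
      rcases eq_or_ne p q with rfl | h
      · simp
      · simp [SimpleGraph.adjMatrix_apply, h]
    have hp : (v : ℝ) + r + θ₁ * θ₂ = 1 + 1 * (v - 1) + r + θ₁ * θ₂ := by ring
    -- Adding this to 2r ≤ b + λ and substituting λ gives 0 ≤ v + b + θ₁θ₂; for the total graph r ≤
    -- b was enough.
    have hs := h₂ ▸ Real.sqrt_nonneg _
    have h2r := hQ.two_mul_r_le
    rw [hp] at h₂ h₃
    constructor
    · have := hQ.inG3_coneGraph hB hθ₁' hθ₂' (Or.inr rfl) ⊤ hH hx hy (by rw [hlam]; ring)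
        (by linarith) (by linarith) h₁ (by rw [← h₂]; ring) (by rw [← h₃]; ring)
      simpa [wholeGraph] using this
    · intro hcard
      have hdeg := hQ.degree_coneGraph hB ⊤ hH
      simp only [one_mul, add_sub_cancel] at hdeg
      obtain ⟨hAP, hAB, hPB⟩ := ne_of_ncard_eq_three hcard
      exact ⟨hQ.isTriregular_coneGraph ⊤ hdeg hcard,
        hQ.coherentRank_coneGraph ⊤ True (by simp) hdeg hAP hAB hPB⟩
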